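/- **Model.** Let $(\epsilon_t)_{t\in\mathbb Z}$ be Gaussian white noise with unit variance (i.i.d. $N(0,1)$), let $(\psi_k)_{k\ge0}$ be a real square-summable sequence, and let market demand be $D_t=\mu+\sum_{k\ge 0}\psi_k\,\epsilon_{t-k}$ (mean-square convergence). Assume that $D$ is invertible with respect to $\epsilon$: every $\epsilon_t$ is a mean-square limit of finite linear combinations of $D_s-\mu$, $s\le t$. Put $\psi(z)=\sum_{k\ge0}\psi_kz^k$ for $|z|<1$, and $\psi_k=0$ for $k<0$. Let $N$ be even, or odd with $N\ge 3$. Let $\sigma_{\mathrm L}=|\psi_0|/N$, let $\sigma>\sigma_{\mathrm L}$, and let $\bar\alpha=\sigma/\sigma_{\mathrm L}$. **Policy.** With $\mathcal B$ the backshift operator, seller $n\in\{1,\dots,N\}$ receives $D_{nt}=\frac{\mu}{N}+\frac1N\mathcal T_n(\mathcal B)(D_t-\mu)$, so its demand has $z$-transform $\psi_n(z)=\frac1N\psi(z)\mathcal T_n(z)$, where - if $N$ is even, or $N$ is odd and $n\ge3$: $\mathcal T_n(z)=1+(-1)^n\bar\alpha z$ (MA(1) sellers); - if $N$ is odd: $\mathcal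 T_1(z)=1+\bar\alpha z+\bar\alpha z^2$ and $\mathcal T_2(z)=1-\bar\alpha z^2$. **Coefficients.** Let $\alpha_n=(-1)^{n+1}\bar\alpha$ for the MA(1) sellers (so that $\mathcal T_n(z)=1-\alpha_nz$), and $\alpha_1=\alpha_2=\bar\alpha$ when $N$ is odd. For $k\ge0$ let $$\theta_{nk}=\begin{cases}\frac1N(\alpha_n\psi_k-\psi_{k-1}), & N\text{ even, or }N\text{ odd and }n\ge3,\\ \frac1N(\alpha_n\psi_k+\alpha_n\psi_{k-1}+\psi_{k-2}), & N\text{ odd},\ n=1,\\ \frac1N(\alpha_n\psi_k-\psi_{k-2}), & N\text{ odd},\ n=2.\end{cases}$$ **Claim.** For every seller $n$ there is an inner–outer factorization $\psi_n=\mathcal O_n\mathcal I_n$ on the open unit disk ($\mathcal O_n\in H^2$ outer, $\mathcal I_n\in H^2$ inner) such that, with $\mathcal O_n(e^{-ix})$ denoting the boundary values of $\mathcal O_n$, $$\frac1{2\pi}\int_{-\pi}^{\pi}e^{ikx}\,\mathcal O_n(e^{-ix})\,dx=\theta_{nk}\qquad(k\ge0).$$ Moreover, for every lead time $L\in\{0,1,2,\dots\}$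 and every $t$, let $\mathcal F_{nt}=\sigma(D_{ns}:s\le t)$ and let $\mathbb D_{n,t+1}=\sum_{\ell=0}^{L}D_{n,t+1+\ell}$ be the lead-time demand. Its mean squared forecast error is almost surely $$\operatorname{Var}\bigl[\mathbb D_{n,t+1}-\mathbb E[\mathbb D_{n,t+1}\mid\mathcal F_{nt}]\,\big|\,\mathcal F_{nt}\bigr]=\sum_{\ell=0}^{L}\Bigl(\sum_{k=0}^{L-\ell}\theta_{nk}\Bigr)^2 .$$ -/

import Mathlib

open MeasureTheory ProbabilityTheory Filter Topology Polynomial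

noncomputable section

/-! ### The Hardy space of the unit disk, inner and outer functions -/

/-- `f` is given on the open unit disk by the power series with coefficients `a`, and `a` is
square summable. -/
def HasHardySeries (f : ℂ → ℂ) (a : ℕ → ℂ) : Prop :=
  (Summable fun k => ‖a k‖ ^ 2) ∧ ∀ z : ℂ, ‖z‖ < 1 → HasSum (fun k => a k * z ^ k) (f z)

/-- Membership in the Hardy space `H²`: analytic on the open unit disk with square-summable Taylor
coefficients.  Values of `f` off the open disk are irrelevant. -/
def MemHardy (f : ℂ → ℂ) : Prop := ∃ a : ℕ → ℂ, HasHardySeries f a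

/-- `f - g` lies in `H²` and has `H²` norm less than `δ`. -/
def HardyDistLT (f g : ℂ → ℂ) (δ : ℝ) : Prop :=
  ∃ a : ℕ → ℂ, HasHardySeries (fun z => f z - g z) a ∧ ∑' k, ‖a k‖ ^ 2 < δ ^ 2

/-- The point `e^{-ix}` of the unit circle. -/
def circlePoint (x : ℝ) : ℂ := Complex.exp (-(x * Complex.I))

/-- Lebesgue measure on `(-π, π]`. -/
def angleMeasure : Measure ℝ := volume.restrict (Set.Ioc (-Real.pi) Real.pi)

/-- `B x` is the boundary value `f (e^{-ix})` of `f`: the square-integrable function which is the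
mean-square limit of `x ↦ f (r e^{-ix})` as `r ↑ 1`. It is unique up to null sets, and it exists
for every `f` in `H²`. -/
def IsBoundaryValue (f : ℂ → ℂ) (B : ℝ → ℂ) : Prop :=
  MemLp B 2 angleMeasure ∧
    Tendsto (fun r : ℝ => eLpNorm (fun x : ℝ => f (r * circlePoint x) - B x) 2 angleMeasure)
      (𝓝[<] 1) (𝓝 0)

/-- Inner functions: members of `H²` whose boundary values are unimodular almost everywhere. -/
def IsInner (f : ℂ → ℂ) : Prop :=
  MemHardy f ∧ ∃ B : ℝ → ℂ, IsBoundaryValue f B ∧ ∀ᵐ x ∂angleMeasure, ‖B x‖ = 1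

/-- Outer functions, in Beurling's form: members of `H²` that are cyclic for the shift, i.e. the
polynomial multiples of `f` are dense in `H²`. -/
def IsOuter (f : ℂ → ℂ) : Prop :=
  MemHardy f ∧ ∀ g : ℂ → ℂ, MemHardy g → ∀ δ : ℝ, 0 < δ →
    ∃ p : ℂ[X], HardyDistLT (fun z => p.eval z * f z) g δ

/-- The coefficient `(1 / 2π) ∫_{-π}^{π} e^{ikx} B(x) dx`, where `B x` stands for `O (e^{-ix})`. -/
def boundaryCoeff (B : ℝ → ℂ) (k : ℕ) : ℂ :=
  1 / (2 * (Real.pi : ℂ)) *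
    ∫ x in (-Real.pi)..Real.pi, Complex.exp (Complex.I * (k : ℂ) * (x : ℂ)) * B x

/-! ### Market demand -/

/-- The demand process `D` with mean `μ`, moving-average coefficients `ψ` and shocks `ε`:
`D_t = μ + ∑_{k ≥ 0} ψ_k ε_{t-k}` with Gaussian white noise `ε` of unit variance and `ψ ∈ ℓ²`,
invertible with respect to `ε`. -/
structure IsMarketDemand {Ω : Type*} [MeasurableSpace Ω] (P : Measure Ω) (μ : ℝ) (ψ : ℕ → ℝ)
    (ε D : ℤ → Ω → ℝ) : Prop where
  measurable_shock : ∀ t, Measurable (ε t)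
  measurable_demand : ∀ t, Measurable (D t)
  indep_shock : iIndepFun ε P
  law_shock : ∀ t, P.map (ε t) = gaussianReal 0 1
  sq_summable : Summable fun k => ψ k ^ 2
  /-- The moving-average series converges to `D_t - μ` in mean square. -/
  moving_average : ∀ t, Tendsto
    (fun m : ℕ => eLpNorm
      (fun ω => D t ω - μ - ∑ k ∈ Finset.range m, ψ k * ε (t - k) ω) 2 P) atTop (𝓝 0)
  /-- Invertibility: every shock is recovered from the history of demand, as a mean-square limit
  of finite linear combinations of the centred past and present demands. -/
  invertible : ∀ t, ∀ δ : ℝ, 0 < δ → ∃ (m : ℕ) (c : ℕ → ℝ),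
    eLpNorm (fun ω => ε t ω - ∑ k ∈ Finset.range m, c k * (D (t - k) ω - μ)) 2 P
      < ENNReal.ofReal δ

/-- The `z`-transform `ψ(z) = ∑ ψ_k z^k`. -/
def zTransform (ψ : ℕ → ℝ) (z : ℂ) : ℂ := ∑' k, (ψ k : ℂ) * z ^ k

/-- The lower bound `σ_L = |ψ_0| / N`. -/
def sigmaLower (N : ℕ) (ψ : ℕ → ℝ) : ℝ := |ψ 0| / N

/-! ### The moving-average allocation policies -/

/-- The transfer function `T_n(z)` of seller `n ∈ {1, …, N}`, with amplitude `a = σ / σ_L`. -/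
def transferPoly (N : ℕ) (a : ℝ) (n : ℕ) : ℝ[X] :=
  if Odd N ∧ n = 1 then 1 + C a * X + C a * X ^ 2
  else if Odd N ∧ n = 2 then 1 - C a * X ^ 2
  else 1 + C ((-1) ^ n * a) * X

/-- Seller demand `D_{n,t} = μ / N + (1 / N) T(𝓑) (D_t - μ)`, where `𝓑` is the backshift. -/
def sellerDemand {Ω : Type*} (N : ℕ) (μ : ℝ) (T : ℝ[X]) (D : ℤ → Ω → ℝ) (t : ℤ) (ω : Ω) : ℝ :=
  μ / N + 1 / N * ∑ k ∈ T.support, T.coeff k * (D (t - k) ω - μ)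

/-- The seller's `z`-transform `ψ_n(z) = (1 / N) ψ(z) T(z)`. -/
def sellerTransform (N : ℕ) (ψ : ℕ → ℝ) (T : ℝ[X]) (z : ℂ) : ℂ :=
  1 / N * zTransform ψ z * aeval z T

/-! ### Lead-time demand and its forecast error -/

/-- The information generated by the history `(Y_s)_{s ≤ t}`. -/
abbrev historySigma {Ω : Type*} (Y : ℤ → Ω → ℝ) (t : ℤ) : MeasurableSpace Ω :=
  ⨆ s : {s : ℤ // s ≤ t}, MeasurableSpace.comap (Y s) inferInstance

/-- Lead-time demand `∑_{ℓ=0}^{L} Y_{t+ℓ}`. -/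
def leadTimeDemand {Ω : Type*} (Y : ℤ → Ω → ℝ) (L : ℕ) (t : ℤ) (ω : Ω) : ℝ :=
  ∑ l ∈ Finset.range (L + 1), Y (t + l) ω

/-- The optimal forecast at time `t` of the lead-time demand starting in period `t + 1`. -/
def leadTimeForecast {Ω : Type*} [MeasurableSpace Ω] (P : Measure Ω) (Y : ℤ → Ω → ℝ) (L : ℕ)
    (t : ℤ) : Ω → ℝ :=
  P[leadTimeDemand Y L (t + 1) | historySigma Y t]

/-- The lead-time mean squared forecast error: the conditional variance, given the history, of the
lead-time demand minus its forecast. -/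
def leadTimeMSFE {Ω : Type*} [MeasurableSpace Ω] (P : Measure Ω) (Y : ℤ → Ω → ℝ) (L : ℕ)
    (t : ℤ) : Ω → ℝ :=
  condVar (historySigma Y t)
    (fun ω => leadTimeDemand Y L (t + 1) ω - leadTimeForecast P Y L t ω) P

/-! ### The explicit coefficients -/

/-- `ψ_j` with the convention `ψ_j = 0` for `j < 0`. -/
def psiExt (ψ : ℕ → ℝ) (j : ℤ) : ℝ := if 0 ≤ j then ψ j.toNat else 0

/-- The signed amplitude `α_n`, with `a = σ / σ_L`: it equals `a` for sellers `1` and `2` when `N`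
is odd, and for all other sellers it is `(-1)^(n+1) a`, so that their transfer function is
`1 - α_n z`. -/
def alphaCoeff (N : ℕ) (a : ℝ) (n : ℕ) : ℝ :=
  if Odd N ∧ (n = 1 ∨ n = 2) then a else (-1) ^ (n + 1) * a

/-- The explicit coefficients `θ_{nk}`, with `α = α_n`. -/
def thetaCoeff (N : ℕ) (ψ : ℕ → ℝ) (α : ℝ) (n k : ℕ) : ℝ :=
  if Odd N ∧ n = 1 then
    1 / N * (α * psiExt ψ k + α * psiExt ψ ((k : ℤ) - 1) + psiExt ψ ((k : ℤ) - 2))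
  else if Odd N ∧ n = 2 then
    1 / N * (α * psiExt ψ k - psiExt ψ ((k : ℤ) - 2))
  else
    1 / N * (α * psiExt ψ k - psiExt ψ ((k : ℤ) - 1))

end

noncomputable section

/-! Let `S` be the shift on ℓ², i.e. multiplication by `z` on H². The isometry `V` into L²(P)
sending the `k`-th unit vector to ε_{τ-k} carries `S ^ m ψ` to D_{τ-m} - μ. Hence invertibility of
demand says that polynomials in `S` applied to ψ come close to the unit vector `1`; as their closed
span is shift-invariant, ψ is cyclic, that is, outer (`IsMarketDemand.isCyclic`).

Let `Q` be the reversal of `T`, up to sign. It has no zero in the closed disk because σ > σ_L, and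
|T| = |Q| on the circle. So `Q(S)` is invertible (`isUnit_aeval`), Qψ/N is still outer, T/Q is
inner, and the coefficients of Qψ/N are the θ_{nk}.

For the forecast error, J = T(S)Q(S)⁻¹ is an isometry commuting with `S`, and seller demand is V S^m
J o with o = Qψ/N. Lead-time demand is V J s with s = (1 + z + ⋯ + z^L) o, up to its mean. Cut s
after degree L. The head is orthogonal to the history, hence independent of it, by joint
Gaussianity; the tail is a limit of combinations of the history, because o is cyclic. The
conditional variance is therefore the squared norm of the head, whose coefficients are partial sums
of θ (`IsWhiteNoise.leadTimeMSFE_eq`). -/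

/-- Square-summable complex sequences, i.e. Taylor coefficients of functions in `H²`. -/
abbrev HardySeq : Type := lp (fun _ : ℕ => ℂ) 2

/-! ### Square-summable sequences and the shift. -/

namespace HardySeq

theorem summable_sq (x : HardySeq) : Summable fun k => ‖x k‖ ^ 2 := by
  have h := (memℓp_gen_iff (by simp) (f := fun k => x k) (p := 2)).1 (lp.memℓp x)
  simpa using h

theorem norm_sq_eq (x : HardySeq) : ‖x‖ ^ 2 = ∑' k, ‖x k‖ ^ 2 := by
  simpa using lp.norm_rpow_eq_tsum (p := 2) (by simp) x

/-- A square-summable sequence as an element of `HardySeq`. -/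
def mk (a : ℕ → ℂ) (h : Summable fun k => ‖a k‖ ^ 2) : HardySeq :=
  ⟨a, memℓp_gen (by simpa using h)⟩

@[simp] theorem mk_apply (a : ℕ → ℂ) (h) (k : ℕ) : mk a h k = a k := rfl

/-- The `k`-th unit vector, the coefficients of `z ^ k`. -/
def unit (k : ℕ) : HardySeq := lp.single 2 k 1

theorem unit_apply (k j : ℕ) : unit k j = if j = k then 1 else 0 := by
  simp [unit, lp.single_apply, Pi.single_apply]

theorem hasSum_unit (x : HardySeq) : HasSum (fun k => x k • unit k) x := by
  have h := lp.hasSum_single (p := 2) (by simp) x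
  convert h using 2 with k
  rw [unit, ← lp.single_smul]; simp

/-- The right shift, multiplication by `z`. -/
def shift : HardySeq →ₗᵢ[ℂ] HardySeq where
  toFun x := mk (fun k => Nat.casesOn k 0 fun j => x j)
    ((summable_nat_add_iff 1).1 (by simpa using summable_sq x))
  map_add' x y := by ext k; cases k <;> simp
  map_smul' c x := by ext k; cases k <;> simp
  norm_map' x := by
    have h : ∀ y : HardySeq, 0 ≤ ‖y‖ := fun y => norm_nonneg y
    rw [← sq_eq_sq₀ (h _) (h _), norm_sq_eq, norm_sq_eq]
    rw [Summable.tsum_eq_zero_add (summable_sq _)]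
    simp

@[simp] theorem shift_zero (x : HardySeq) : shift x 0 = 0 := rfl
@[simp] theorem shift_succ (x : HardySeq) (k : ℕ) : shift x (k + 1) = x k := rfl

theorem shift_unit (k : ℕ) : shift (unit k) = unit (k + 1) := by
  ext j; cases j <;> simp [unit_apply]

/-- The right shift as an element of the operator algebra. -/
abbrev shiftL : HardySeq →L[ℂ] HardySeq := shift.toContinuousLinearMap

theorem shiftL_pow_apply_of_lt (x : HardySeq) {m k : ℕ} (h : k < m) : (shiftL ^ m) x k = 0 := by
  induction m generalizing k with
  | zero => omega
  | succ m ih =>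
    rw [pow_succ', mul_apply_eq_comp]
    cases k with
    | zero => simp
    | succ k => simpa using ih (by omega)

theorem shiftL_pow_apply_add (x : HardySeq) (m k : ℕ) : (shiftL ^ m) x (k + m) = x k := by
  induction m with
  | zero => simp
  | succ m ih => rw [pow_succ', mul_apply_eq_comp]; simpa [← add_assoc] using ih

theorem shiftL_pow_unit (m k : ℕ) : (shiftL ^ m) (unit k) = unit (k + m) := by
  induction m with
  | zero => simp
  | succ m ih => rw [pow_succ', mul_apply_eq_comp, ih]; simp [shift_unit, add_assoc]

/-! ### Point evaluations -/

theorem summable_pow_sq {z : ℂ} (hz : ‖z‖ < 1) :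
    Summable fun k => ‖(starRingEnd ℂ z) ^ k‖ ^ 2 := by
  have : ‖z‖ ^ 2 < 1 := by nlinarith [norm_nonneg z]
  refine (summable_geometric_of_lt_one (by positivity) this).congr fun k => ?_
  simp [← pow_mul, mul_comm]

/-- The reproducing kernel of `H²` at a point of the open disk. -/
def kernel (z : ℂ) (hz : ‖z‖ < 1) : HardySeq := mk _ (summable_pow_sq hz)

theorem hasSum_eval (x : HardySeq) {z : ℂ} (hz : ‖z‖ < 1) :
    HasSum (fun k => x k * z ^ k) (inner ℂ (kernel z hz) x) := by
  have h := lp.hasSum_inner (𝕜 := ℂ) (kernel z hz) x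
  simpa [kernel, mul_comm] using h

theorem eval_shift (x : HardySeq) {z : ℂ} (hz : ‖z‖ < 1) :
    inner ℂ (kernel z hz) (shift x) = z * inner ℂ (kernel z hz) x := by
  have h1 := (hasSum_nat_add_iff' 1).2 (hasSum_eval (shift x) hz)
  have h2 := (hasSum_eval x hz).mul_left z
  simp only [Finset.range_one, Finset.sum_singleton, shift_zero, zero_mul, sub_zero,
    shift_succ] at h1
  exact h1.unique (by simpa only [pow_succ', mul_comm, mul_left_comm, mul_assoc] using h2)

theorem eval_aeval (p : ℂ[X]) (x : HardySeq) {z : ℂ} (hz : ‖z‖ < 1) :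
    inner ℂ (kernel z hz) (aeval shiftL p x) = p.eval z * inner ℂ (kernel z hz) x := by
  induction p using Polynomial.induction_on' with
  | add p q hp hq => simp [hp, hq, add_mul]
  | monomial n a =>
    rw [aeval_monomial]
    simp only [Algebra.algebraMap_eq_smul_one, eval_monomial,
      smul_mul_assoc, one_mul, smul_apply, inner_smul_right, mul_assoc]
    congr 1
    induction n with
    | zero => simp
    | succ n ih =>
      rw [pow_succ', mul_apply_eq_comp]
      simp only [LinearIsometry.coe_toContinuousLinearMap, eval_shift, ih]
      ring

theorem hasHardySeries (x : HardySeq) {f : ℂ → ℂ}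
    (hf : ∀ z : ℂ, ∀ hz : ‖z‖ < 1, f z = inner ℂ (kernel z hz) x) : HasHardySeries f x :=
  ⟨summable_sq x, fun z hz => hf z hz ▸ hasSum_eval x hz⟩

theorem exists_of_memHardy {f : ℂ → ℂ} (hf : MemHardy f) :
    ∃ x : HardySeq, ∀ z : ℂ, ∀ hz : ‖z‖ < 1, f z = inner ℂ (kernel z hz) x := by
  obtain ⟨a, ha, h⟩ := hf
  exact ⟨mk a ha, fun z hz => (h z hz).unique (hasSum_eval (mk a ha) hz)⟩

/-! ### Cyclic vectors -/

/-- Cyclic vectors of the shift. -/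
def IsCyclic (x : HardySeq) : Prop := DenseRange fun p : ℂ[X] => aeval shiftL p x

theorem IsCyclic.isOuter {x : HardySeq} (hx : IsCyclic x) {f : ℂ → ℂ}
    (hf : ∀ z : ℂ, ∀ hz : ‖z‖ < 1, f z = inner ℂ (kernel z hz) x) : IsOuter f := by
  refine ⟨⟨x, hasHardySeries x hf⟩, fun g hg δ hδ => ?_⟩
  obtain ⟨y, hy⟩ := exists_of_memHardy hg
  obtain ⟨p, hp⟩ := Metric.denseRange_iff.1 hx y δ hδ
  have h1 : HasHardySeries (fun z => p.eval z * f z - g z) (aeval shiftL p x - y : HardySeq) :=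
    hasHardySeries _ fun z hz => by rw [inner_sub_right, eval_aeval, hf z hz, hy z hz]
  refine ⟨p, _, h1, ?_⟩
  rw [← norm_sq_eq, ← dist_eq_norm, dist_comm]
  exact pow_lt_pow_left₀ hp dist_nonneg two_ne_zero

/-- The closure of the polynomial multiples of `x` is a shift-invariant closed subspace, so once it
contains the constant 1 it contains every power of `z`. -/
theorem isCyclic_of_approx {x : HardySeq}
    (h : ∀ δ : ℝ, 0 < δ → ∃ p : ℂ[X], ‖unit 0 - aeval shiftL p x‖ < δ) : IsCyclic x := by
  let ev : ℂ[X] →ₗ[ℂ] HardySeq :=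
    (ContinuousLinearMap.apply ℂ HardySeq x).toLinearMap ∘ₗ (aeval shiftL).toLinearMap
  let M := (LinearMap.range ev).topologicalClosure
  have hS : ∀ y ∈ M, shift y ∈ M := by
    intro y hy
    refine map_mem_closure shift.continuous hy ?_
    rintro _ ⟨p, rfl⟩
    exact ⟨X * p, congrArg (fun A : HardySeq →L[ℂ] HardySeq => A x)
      (by rw [map_mul, aeval_X] : aeval shiftL (X * p) = shiftL * aeval shiftL p)⟩
  have h0 : unit 0 ∈ M := by
    refine Metric.mem_closure_iff.2 fun δ hδ => ?_
    obtain ⟨p, hp⟩ := h δ hδ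
    exact ⟨_, ⟨p, rfl⟩, by rwa [dist_eq_norm]⟩
  have hk : ∀ k, unit k ∈ M := by
    intro k
    induction k with
    | zero => exact h0
    | succ k ih => exact shift_unit k ▸ hS _ ih
  have hM : ∀ y, y ∈ M := fun y =>
    (Submodule.isClosed_topologicalClosure _).mem_of_tendsto (hasSum_unit y)
      (Eventually.of_forall fun s => Submodule.sum_mem _ fun k _ => Submodule.smul_mem _ _ (hk k))
  exact fun y => hM y

/-! ### Invertible polynomials in the shift and inner multipliers. -/

theorem surjective_of_isUnit {A : HardySeq →L[ℂ] HardySeq} (hA : IsUnit A) :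
    Function.Surjective A := by
  obtain ⟨u, rfl⟩ := hA
  intro y
  refine ⟨(↑u⁻¹ : HardySeq →L[ℂ] HardySeq) y, ?_⟩
  rw [← mul_apply_eq_comp, Units.mul_inv]; rfl

theorem IsCyclic.aeval_of_isUnit {x : HardySeq} (hx : IsCyclic x) {Q : ℂ[X]}
    (hQ : IsUnit (aeval shiftL Q)) : IsCyclic (aeval shiftL Q x) := by
  have h := (surjective_of_isUnit hQ).denseRange.comp hx (aeval shiftL Q).continuous
  refine h.mono ?_
  rintro _ ⟨p, rfl⟩
  refine ⟨p, ?_⟩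
  simp only [Function.comp, ← mul_apply_eq_comp, ← map_mul, mul_comm]

instance : Nontrivial HardySeq :=
  ⟨unit 0, 0, fun h => by simpa [unit_apply] using congrArg (fun y : HardySeq => y 0) h⟩

/-- The shift has norm at most 1, so its spectrum lies in the closed disk; spectral mapping then
keeps 0 out of the spectrum of `Q(S)`. -/
theorem isUnit_aeval {Q : ℂ[X]} (hQ : ∀ z : ℂ, ‖z‖ ≤ 1 → Q.eval z ≠ 0) :
    IsUnit (aeval shiftL Q) := by
  rw [← spectrum.zero_notMem_iff ℂ,
    spectrum.map_polynomial_aeval_of_nonempty shiftL Q (spectrum.nonempty shiftL)]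
  rintro ⟨z, hz, h0⟩
  refine hQ z ((spectrum.norm_le_norm_of_mem hz).trans ?_) h0
  exact shift.norm_toContinuousLinearMap_le

/-- Multiplication by the inner function `T / Q`. -/
theorem exists_innerOperator {T Q : ℂ[X]} (hQ : IsUnit (aeval shiftL Q))
    (h : ∀ y, ‖aeval shiftL T y‖ = ‖aeval shiftL Q y‖) :
    ∃ J : HardySeq →ₗᵢ[ℂ] HardySeq, (∀ x, J (shift x) = shift (J x)) ∧
      ∀ x, J (aeval shiftL Q x) = aeval shiftL T x := by
  have hcomm : ∀ (p : ℂ[X]) x, aeval shiftL p (shift x) = shift (aeval shiftL p x) := fun p x =>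
    congrArg (fun A : HardySeq →L[ℂ] HardySeq => A x)
      (by simpa using congrArg (aeval shiftL) (mul_comm p X) :
        aeval shiftL p * shiftL = shiftL * aeval shiftL p)
  have hs := surjective_of_isUnit hQ
  obtain ⟨u, hu⟩ := hQ
  have hJ : ∀ x, (aeval shiftL T * (↑u⁻¹ : HardySeq →L[ℂ] HardySeq)) (aeval shiftL Q x) =
      aeval shiftL T x := by
    intro x
    rw [← mul_apply_eq_comp, ← hu, mul_assoc, Units.inv_mul, mul_one]
  refine ⟨⟨(aeval shiftL T * (↑u⁻¹ : HardySeq →L[ℂ] HardySeq)).toLinearMap, fun x => ?_⟩,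
    fun x => ?_, fun x => hJ x⟩
  -- Every vector is some `Q(S) y`, on which the operator acts as `T(S) y`; isometry and commutation
  -- need checking only in this form.
  · obtain ⟨y, rfl⟩ := hs x
    exact (congrArg norm (hJ y)).trans (h y)
  · obtain ⟨y, rfl⟩ := hs x
    have h1 := hJ (shift y)
    rw [hcomm, hcomm] at h1
    exact h1.trans (congrArg shift (hJ y)).symm

theorem eval_unit_zero {z : ℂ} (hz : ‖z‖ < 1) : inner ℂ (kernel z hz) (unit 0) = 1 := by
  refine (hasSum_eval (unit 0) hz).unique ?_
  convert hasSum_ite_eq 0 (1 : ℂ) using 2 with k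
  by_cases hk : k = 0 <;> simp [hk, unit_apply]

/-- Solving `Q(S) y = 1` makes the value of `y` at `z` equal to `1 / Q(z)`. -/
theorem eval_innerOperator {T Q : ℂ[X]} (hQ : IsUnit (aeval shiftL Q))
    {J : HardySeq →ₗᵢ[ℂ] HardySeq} (hJ : ∀ x, J (aeval shiftL Q x) = aeval shiftL T x)
    {z : ℂ} (hz : ‖z‖ < 1) :
    inner ℂ (kernel z hz) (J (unit 0)) = T.eval z / Q.eval z := by
  obtain ⟨y, hy⟩ := surjective_of_isUnit hQ (unit 0)
  have h1 := eval_unit_zero hz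
  rw [← hy, eval_aeval] at h1
  have h2 : Q.eval z ≠ 0 := fun h => by simp [h] at h1
  rw [← hy, hJ, eval_aeval, eq_div_iff h2, mul_assoc, mul_comm _ (Q.eval z), h1, mul_one]

end HardySeq

namespace HardySeq

/-! ### Boundary values -/

instance : IsFiniteMeasure angleMeasure := by
  unfold angleMeasure; infer_instance

theorem norm_circlePoint (x : ℝ) : ‖circlePoint x‖ = 1 := by
  rw [circlePoint, ← neg_mul, ← Complex.ofReal_neg, Complex.norm_exp_ofReal_mul_I]

@[fun_prop]
theorem continuous_circlePoint : Continuous circlePoint := by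
  unfold circlePoint; fun_prop

theorem memLp_circlePoint_pow (k : ℕ) : MemLp (fun x => circlePoint x ^ k) 2 angleMeasure := by
  refine MemLp.of_bound (C := 1) (by fun_prop) (Eventually.of_forall fun x => ?_)
  simp [norm_circlePoint]

theorem integral_circlePoint (j k : ℕ) :
    ∫ x, (starRingEnd ℂ (circlePoint x ^ j)) * circlePoint x ^ k ∂angleMeasure =
      if j = k then 2 * (Real.pi : ℂ) else 0 := by
  have hpi : -Real.pi ≤ Real.pi := by linarith [Real.pi_pos]
  have h : ∀ x : ℝ, (starRingEnd ℂ (circlePoint x ^ j)) * circlePoint x ^ k =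
      Complex.exp (((j : ℂ) - k) * Complex.I * x) := by
    intro x
    rw [circlePoint, map_pow, ← Complex.exp_conj, ← Complex.exp_nat_mul, ← Complex.exp_nat_mul,
      ← Complex.exp_add]
    congr 1
    simp
    ring
  simp_rw [h]
  rw [angleMeasure, ← intervalIntegral.integral_of_le hpi]
  split_ifs with hjk
  · simp [hjk]; ring
  · have hne : ((j : ℂ) - k) * Complex.I ≠ 0 :=
      mul_ne_zero (sub_ne_zero.2 (by exact_mod_cast hjk)) Complex.I_ne_zero
    rw [integral_exp_mul_complex hne, div_eq_zero_iff]
    left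
    rw [sub_eq_zero, Complex.exp_eq_exp_iff_exists_int]
    exact ⟨(j : ℤ) - k, by push_cast; ring⟩

/-- The normalized characters `x ↦ (2π)^{-1/2} e^{-ikx}`. -/
def character (k : ℕ) : Lp ℂ 2 angleMeasure :=
  ((√(2 * Real.pi))⁻¹ : ℂ) • (memLp_circlePoint_pow k).toLp _

theorem orthonormal_character : Orthonormal ℂ character := by
  rw [orthonormal_iff_ite]
  intro j k
  have hpi : (0 : ℝ) < 2 * Real.pi := by positivity
  have h : inner ℂ ((memLp_circlePoint_pow j).toLp _) ((memLp_circlePoint_pow k).toLp _) =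
      if j = k then 2 * (Real.pi : ℂ) else 0 := by
    rw [← integral_circlePoint, L2.inner_def]
    refine integral_congr_ae ?_
    filter_upwards [(memLp_circlePoint_pow j).coeFn_toLp, (memLp_circlePoint_pow k).coeFn_toLp]
      with x h1 h2
    rw [h1, h2, RCLike.inner_apply, mul_comm]
  rw [character, character, inner_smul_left, inner_smul_right, h]
  split_ifs
  · rw [← mul_assoc, ← Complex.ofReal_inv, Complex.conj_ofReal, ← Complex.ofReal_mul, ← mul_inv,
      Real.mul_self_sqrt hpi.le]
    push_cast
    field_simp
  · simp

/-- The Fourier isometry. -/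
def fourier : HardySeq →ₗᵢ[ℂ] Lp ℂ 2 angleMeasure :=
  orthonormal_character.orthogonalFamily.linearIsometry

theorem hasSum_fourier (x : HardySeq) : HasSum (fun k => x k • character k) (fourier x) := by
  exact orthonormal_character.orthogonalFamily.hasSum_linearIsometry x

theorem inner_character_fourier (x : HardySeq) (k : ℕ) :
    inner ℂ (character k) (fourier x) = x k := by
  have h : character k = fourier (unit k) := by
    simp [fourier, unit, orthonormal_character.orthogonalFamily.linearIsometry_apply_single]
  rw [h, LinearIsometry.inner_map_map, unit, lp.inner_single_left]
  simp

/-- The coefficients of `z ↦ f (r z)`. -/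
def dilate (r : ℝ) (hr : |r| ≤ 1) (x : HardySeq) : HardySeq :=
  mk (fun k => x k * (r : ℂ) ^ k) (by
    refine Summable.of_nonneg_of_le (fun k => by positivity) (fun k => ?_) (summable_sq x)
    rw [norm_mul, norm_pow, Complex.norm_real, mul_pow]
    exact mul_le_of_le_one_right (by positivity)
      (pow_le_one₀ (by positivity) (pow_le_one₀ (norm_nonneg _) hr)))

/-- Dominated convergence in ℓ², using |r^k - 1| ≤ 1 for 0 < r < 1. -/
theorem tendsto_dilate (x : HardySeq) {u : ℝ → HardySeq}
    (hu : ∀ᶠ r in 𝓝[<] (1 : ℝ), ∀ k, u r k = x k * (r : ℂ) ^ k) :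
    Tendsto u (𝓝[<] 1) (𝓝 x) := by
  rw [tendsto_iff_norm_sub_tendsto_zero]
  have h0 : Tendsto (fun r : ℝ => ∑' k, ‖x k * (r : ℂ) ^ k - x k‖ ^ 2) (𝓝[<] 1)
      (𝓝 (∑' _ : ℕ, (0 : ℝ))) := by
    refine tendsto_tsum_of_dominated_convergence (bound := fun k => ‖x k‖ ^ 2) (summable_sq x)
      (fun k => ?_) ?_
    · have : Continuous fun r : ℝ => ‖x k * (r : ℂ) ^ k - x k‖ ^ 2 := by fun_prop
      exact (this.tendsto' 1 0 (by simp)).mono_left nhdsWithin_le_nhds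
    · filter_upwards [Ioo_mem_nhdsLT (zero_lt_one (α := ℝ))] with r hr k
      have h1 : x k * (r : ℂ) ^ k - x k = x k * ((r ^ k - 1 : ℝ) : ℂ) := by push_cast; ring
      have h2 : |r ^ k - 1| ≤ 1 := by
        rw [abs_le]
        have := pow_nonneg hr.1.le k
        have := pow_le_one₀ hr.1.le hr.2.le (n := k)
        constructor <;> linarith
      rw [h1, norm_mul, Complex.norm_real, Real.norm_of_nonneg (by positivity), mul_pow]
      exact mul_le_of_le_one_right (by positivity) (pow_le_one₀ (abs_nonneg _) h2)
  rw [tsum_zero] at h0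
  have h2 := (Real.continuous_sqrt.tendsto 0).comp h0
  rw [Real.sqrt_zero] at h2
  refine h2.congr' ?_
  filter_upwards [hu] with r hr
  rw [Function.comp, Real.sqrt_eq_iff_mul_self_eq (by positivity) (by positivity), ← sq, norm_sq_eq]
  simp [hr]

/-- The partial sums converge in L² to the Fourier image and pointwise to `g`; an a.e. convergent
subsequence identifies the two limits. -/
theorem fourier_ae_eq (x : HardySeq) {g : ℝ → ℂ}
    (h : ∀ t, HasSum (fun k => x k * circlePoint t ^ k) (g t)) :
    (fun t => (√(2 * Real.pi) : ℂ) * fourier x t) =ᵐ[angleMeasure] g := by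
  have h1 := (hasSum_fourier x).tendsto_sum_nat.const_smul (√(2 * Real.pi) : ℂ)
  obtain ⟨ns, hns, hae⟩ := (tendstoInMeasure_of_tendsto_Lp h1).exists_seq_tendsto_ae
  have hc : ((√(2 * Real.pi) : ℝ) : ℂ) ≠ 0 := by
    exact_mod_cast (Real.sqrt_pos.2 (by positivity)).ne'
  have h2 : ∀ m : ℕ, ((√(2 * Real.pi) : ℂ) • ∑ k ∈ Finset.range m, x k • character k :
      Lp ℂ 2 angleMeasure) =ᵐ[angleMeasure]
      fun t => ∑ k ∈ Finset.range m, x k * circlePoint t ^ k := by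
    intro m
    induction m with
    | zero =>
      rw [Finset.range_zero, Finset.sum_empty, smul_zero]
      exact Lp.coeFn_zero ℂ 2 angleMeasure
    | succ m ih =>
      rw [Finset.sum_range_succ, smul_add, smul_comm _ (x m), character, smul_inv_smul₀ hc]
      filter_upwards [ih, Lp.coeFn_add ((√(2 * Real.pi) : ℂ) • ∑ k ∈ Finset.range m,
        x k • character k) (x m • (memLp_circlePoint_pow m).toLp _),
        Lp.coeFn_smul (x m) ((memLp_circlePoint_pow m).toLp _),
        (memLp_circlePoint_pow m).coeFn_toLp] with t h3 h4 h5 h6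
      rw [h4, Pi.add_apply, h3, h5, Pi.smul_apply, h6, Finset.sum_range_succ, smul_eq_mul]
  filter_upwards [hae, ae_all_iff.2 h2, Lp.coeFn_smul (√(2 * Real.pi) : ℂ) (fourier x)]
    with t h3 h4 h5
  rw [h5, Pi.smul_apply, smul_eq_mul] at h3
  refine tendsto_nhds_unique h3 ?_
  simp_rw [h4]
  exact (h t).tendsto_sum_nat.comp hns.tendsto_atTop

/-- The boundary function of the power series with coefficients `x`. -/
def boundary (x : HardySeq) (t : ℝ) : ℂ := √(2 * Real.pi) * fourier x t

theorem isBoundaryValue {f : ℂ → ℂ} {x : HardySeq}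
    (hf : ∀ z : ℂ, ∀ hz : ‖z‖ < 1, f z = inner ℂ (kernel z hz) x) :
    IsBoundaryValue f (boundary x) := by
  refine ⟨(Lp.memLp (fourier x)).const_mul _, ?_⟩
  let u : ℝ → HardySeq := fun r => if h : |r| ≤ 1 then dilate r h x else 0
  have hev : ∀ᶠ r in 𝓝[<] (1 : ℝ), 0 < r ∧ r < 1 := Ioo_mem_nhdsLT (zero_lt_one (α := ℝ))
  have hu : ∀ r : ℝ, 0 < r → r < 1 → ∀ k, u r k = x k * (r : ℂ) ^ k := by
    intro r h0 h1 k
    have h : |r| ≤ 1 := by rw [abs_of_pos h0]; exact h1.le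
    simp [u, h, dilate]
  have h1 : Tendsto (fun r => (√(2 * Real.pi) : ℂ) • fourier (u r)) (𝓝[<] 1)
      (𝓝 ((√(2 * Real.pi) : ℂ) • fourier x)) :=
    ((fourier.continuous.tendsto x).comp
      (tendsto_dilate x (hev.mono fun r hr => hu r hr.1 hr.2))).const_smul _
  refine ((Lp.tendsto_Lp_iff_tendsto_eLpNorm' _ _).1 h1).congr' ?_
  filter_upwards [hev] with r hr
  refine eLpNorm_congr_ae ?_
  have h2 : ∀ t, HasSum (fun k => u r k * circlePoint t ^ k) (f (r * circlePoint t)) := by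
    intro t
    have hz : ‖(r : ℂ) * circlePoint t‖ < 1 := by
      rw [norm_mul, norm_circlePoint, mul_one, Complex.norm_real, Real.norm_of_nonneg hr.1.le]
      exact hr.2
    simpa only [hu r hr.1 hr.2, mul_pow, mul_assoc, hf _ hz] using hasSum_eval x hz
  filter_upwards [fourier_ae_eq (u r) h2, Lp.coeFn_smul (√(2 * Real.pi) : ℂ) (fourier x),
    Lp.coeFn_smul (√(2 * Real.pi) : ℂ) (fourier (u r))] with t h3 h4 h5
  rw [Pi.sub_apply, h4, h5, ← h3, boundary]
  rfl

theorem boundaryCoeff_boundary (x : HardySeq) (k : ℕ) : boundaryCoeff (boundary x) k = x k := by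
  have hpi : (0 : ℝ) < 2 * Real.pi := by positivity
  rw [boundaryCoeff, intervalIntegral.integral_of_le (by linarith [Real.pi_pos]),
    ← inner_character_fourier, L2.inner_def, ← integral_const_mul]
  refine integral_congr_ae ?_
  filter_upwards [Lp.coeFn_smul ((√(2 * Real.pi))⁻¹ : ℂ) ((memLp_circlePoint_pow k).toLp _),
    (memLp_circlePoint_pow k).coeFn_toLp] with t h1 h2
  have h3 : (starRingEnd ℂ) (circlePoint t ^ k) = Complex.exp (Complex.I * k * t) := by
    rw [circlePoint, map_pow, ← Complex.exp_conj, ← Complex.exp_nat_mul]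
    congr 1
    simp
    ring
  have h4 : ((√(2 * Real.pi) : ℝ) : ℂ) * (√(2 * Real.pi) : ℝ) = 2 * Real.pi := by
    rw [← Complex.ofReal_mul, Real.mul_self_sqrt hpi.le]; push_cast; rfl
  have hc : ((√(2 * Real.pi) : ℝ) : ℂ) ≠ 0 := by
    exact_mod_cast (Real.sqrt_pos.2 hpi).ne'
  rw [character, h1, Pi.smul_apply, h2, RCLike.inner_apply, smul_eq_mul, map_mul, h3, boundary,
    ← h4, ← Complex.ofReal_inv, Complex.conj_ofReal, Complex.ofReal_inv]
  field_simp

/-- A quotient of polynomials with unimodular boundary values is inner. -/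
theorem isInner_of_div {T Q : ℂ[X]} {x : HardySeq} (hQ : ∀ z : ℂ, ‖z‖ ≤ 1 → Q.eval z ≠ 0)
    (hT : ∀ z : ℂ, ‖z‖ = 1 → ‖T.eval z‖ = ‖Q.eval z‖)
    (hx : ∀ z : ℂ, ∀ hz : ‖z‖ < 1, inner ℂ (kernel z hz) x = T.eval z / Q.eval z) :
    IsInner fun z => T.eval z / Q.eval z := by
  have hf : ∀ z : ℂ, ∀ hz : ‖z‖ < 1, T.eval z / Q.eval z = inner ℂ (kernel z hz) x :=
    fun z hz => (hx z hz).symm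
  refine ⟨⟨x, hasHardySeries x hf⟩, boundary x, isBoundaryValue hf, ?_⟩
  obtain ⟨-, h⟩ := isBoundaryValue hf
  obtain ⟨r, hr1⟩ := exists_seq_strictMono_tendsto (1 : ℝ)
  have hr : Tendsto r atTop (𝓝[<] 1) :=
    tendsto_nhdsWithin_iff.2 ⟨hr1.2.2, Eventually.of_forall hr1.2.1⟩
  have hmeas : ∀ n, AEStronglyMeasurable
      (fun t => T.eval (r n * circlePoint t) / Q.eval (r n * circlePoint t)) angleMeasure := by
    intro n
    have h1 : Continuous fun t => (r n : ℂ) * circlePoint t := by fun_prop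
    exact ((T.continuous.comp h1).measurable.div
      (Q.continuous.comp h1).measurable).aestronglyMeasurable
  -- Along a subsequence of radii the L² boundary limit is also an a.e. limit. Since `Q` has no zero
  -- on the circle, the radial limit is the quotient itself, of modulus 1.
  obtain ⟨ns, hns, hae⟩ := (tendstoInMeasure_of_tendsto_eLpNorm two_ne_zero hmeas
    (isBoundaryValue hf).1.1 (h.comp hr)).exists_seq_tendsto_ae
  filter_upwards [hae] with t ht
  have h1 : Tendsto (fun n => (r (ns n) : ℂ) * circlePoint t) atTop (𝓝 (circlePoint t)) := by
    have h2 : Continuous fun s : ℝ => (s : ℂ) * circlePoint t := by fun_prop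
    exact (h2.tendsto' 1 _ (by simp)).comp (hr1.2.2.comp hns.tendsto_atTop)
  have hc := norm_circlePoint t
  have h0 := hQ _ hc.le
  have h3 := ((T.continuous.tendsto _).comp h1).div ((Q.continuous.tendsto _).comp h1) h0
  rw [tendsto_nhds_unique ht h3, norm_div, hT _ hc, div_self (norm_ne_zero_iff.2 h0)]

end HardySeq

/-! ### Gaussian limits -/

/-- Mean-square limits of centred Gaussian variables are Gaussian. -/
theorem hasGaussianLaw_of_tendsto {Ω : Type*} [MeasurableSpace Ω] {P : Measure Ω}
    [IsProbabilityMeasure P] {X : ℕ → Ω → ℝ} {Y : Ω → ℝ} (hX : ∀ n, HasGaussianLaw (X n) P)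
    (hX0 : ∀ n, P[X n] = 0) (hY : MemLp Y 2 P) (hY0 : P[Y] = 0)
    (h : Tendsto (fun n => eLpNorm (X n - Y) 2 P) atTop (𝓝 0)) : HasGaussianLaw Y P := by
  have hXm : ∀ n, MemLp (X n) 2 P := fun n => (hX n).memLp_two
  have hvar : Tendsto (fun n => Var[X n; P]) atTop (𝓝 Var[Y; P]) := by
    have h1 := (Lp.tendsto_Lp_iff_tendsto_eLpNorm'' X hXm Y hY).2 h
    have h2 : ∀ {Z : Ω → ℝ} (hZ : MemLp Z 2 P), P[Z] = 0 → Var[Z; P] = ‖hZ.toLp Z‖ ^ 2 := by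
      intro Z hZ hZ0
      rw [variance_of_integral_eq_zero hZ.1.aemeasurable hZ0, ← real_inner_self_eq_norm_sq,
        L2.inner_def]
      refine integral_congr_ae ?_
      filter_upwards [hZ.coeFn_toLp] with ω hω
      simp [hω, sq]
    rw [h2 hY hY0]
    refine Tendsto.congr (fun n => (h2 (hXm n) (hX0 n)).symm) ?_
    exact h1.norm.pow 2
  rw [hasGaussianLaw_iff_charFun_map_eq hY.1.aemeasurable]
  intro t
  have hm := tendstoInMeasure_of_tendsto_eLpNorm two_ne_zero (fun n => (hXm n).1) hY.1 h
  obtain ⟨ns, hns, hae⟩ := hm.exists_seq_tendsto_ae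
  have hchar : ∀ {Z : Ω → ℝ}, AEMeasurable Z P →
      charFun (P.map Z) t = ∫ ω, Complex.exp (t * Z ω * Complex.I) ∂P := by
    intro Z hZ
    rw [charFun_apply_real, integral_map hZ (by fun_prop)]
  have hlin : ∀ Z : Ω → ℝ, P[Z] = 0 → P[fun ω => inner ℝ t (Z ω)] = 0 := by
    intro Z hZ
    simp [integral_mul_const, hZ]
  have hlinv : ∀ Z : Ω → ℝ, Var[fun ω => inner ℝ t (Z ω); P] = t ^ 2 * Var[Z; P] := by
    intro Z
    simp_rw [← variance_const_mul]
    congr 1; ext ω; simp [mul_comm]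
  -- Characteristic functions converge along an a.e. convergent subsequence, while the Gaussian
  -- formula depends continuously on the variance, which converges by `hvar`.
  have hl1 : Tendsto (fun n => charFun (P.map (X (ns n))) t) atTop (𝓝 (charFun (P.map Y) t)) := by
    rw [hchar hY.1.aemeasurable]
    simp_rw [fun n => hchar (hXm (ns n)).1.aemeasurable]
    refine tendsto_integral_of_dominated_convergence (fun _ => 1) (fun n => ?_) (by simp)
      (fun n => Eventually.of_forall fun ω => ?_) ?_
    · have := (hXm (ns n)).1.aemeasurable
      exact AEMeasurable.aestronglyMeasurable (by fun_prop)
    · rw [← Complex.ofReal_mul, Complex.norm_exp_ofReal_mul_I]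
    · filter_upwards [hae] with ω hω
      have hc : Continuous fun y : ℝ => Complex.exp (t * y * Complex.I) := by fun_prop
      exact (hc.tendsto _).comp hω
  refine tendsto_nhds_unique hl1 ?_
  simp_rw [fun n => (hX (ns n)).charFun_map_eq t, hlinv, hlin Y hY0, fun n => hlin _ (hX0 (ns n))]
  have hc : Continuous fun v : ℝ =>
      Complex.exp (((0 : ℝ) : ℂ) * Complex.I - ((t ^ 2 * v : ℝ) : ℂ) / 2) := by fun_prop
  exact (hc.tendsto _).comp (hvar.comp hns.tendsto_atTop)

/-! ### White noise and its Hilbert space -/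

/-- A sequence of independent standard Gaussian variables. -/
structure IsWhiteNoise {Ω : Type*} [MeasurableSpace Ω] (P : Measure Ω) (ξ : ℕ → Ω → ℝ) :
    Prop where
  measurable : ∀ k, Measurable (ξ k)
  indep : iIndepFun ξ P
  law : ∀ k, P.map (ξ k) = gaussianReal 0 1

/-- Linear combinations commute with an isometry into `L²`, up to null sets. -/
theorem coeFn_isometry_sum {Ω : Type*} [MeasurableSpace Ω] {P : Measure Ω}
    (V : HardySeq →ₗᵢ[ℂ] Lp ℂ 2 P) {ι : Type*} [Countable ι] {x : ι → HardySeq}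
    {Z : ι → Ω → ℂ} (h : ∀ k, V (x k) =ᵐ[P] Z k) (a : ι → ℂ) (s : Finset ι) :
    V (∑ k ∈ s, a k • x k) =ᵐ[P] fun ω => ∑ k ∈ s, a k * Z k ω := by
  rw [map_sum]
  have h1 : ∀ k, V (a k • x k) =ᵐ[P] fun ω => a k * Z k ω := by
    intro k
    rw [map_smul]
    filter_upwards [Lp.coeFn_smul (a k) (V (x k)), h k] with ω h1 h2
    rw [h1, Pi.smul_apply, h2, smul_eq_mul]
  filter_upwards [Lp.coeFn_finsetSum s fun k => V (a k • x k), ae_all_iff.2 h1] with ω h2 h3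
  rw [h2, Finset.sum_apply]
  exact Finset.sum_congr rfl fun k _ => h3 k

namespace IsWhiteNoise

open HardySeq

variable {Ω : Type*} [MeasurableSpace Ω] {P : Measure Ω} {ξ : ℕ → Ω → ℝ}

theorem hasGaussianLaw (hξ : IsWhiteNoise P ξ) (k : ℕ) : HasGaussianLaw (ξ k) P :=
  ⟨hξ.law k ▸ inferInstance⟩

theorem integral_eq_zero (hξ : IsWhiteNoise P ξ) (k : ℕ) : P[ξ k] = 0 := by
  have h := integral_map (hξ.measurable k).aemeasurable (f := id) (μ := P)
    (by fun_prop)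
  rw [hξ.law] at h
  simpa using h.symm

theorem integral_mul (hξ : IsWhiteNoise P ξ) (j k : ℕ) :
    ∫ ω, ξ j ω * ξ k ω ∂P = if j = k then 1 else 0 := by
  have := (hξ.hasGaussianLaw 0).isProbabilityMeasure
  split_ifs with h
  · subst h
    have h1 := variance_of_integral_eq_zero (hξ.measurable j).aemeasurable (hξ.integral_eq_zero j)
    have h2 := variance_map (X := id) (μ := P) (Y := ξ j) (by fun_prop)
      (hξ.measurable j).aemeasurable
    rw [hξ.law, variance_id_gaussianReal] at h2
    simp_rw [← sq, ← h1]
    simpa using h2.symm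
  · have h1 := (hξ.indep.indepFun h).integral_mul_eq_mul_integral
      (hξ.measurable j).aestronglyMeasurable (hξ.measurable k).aestronglyMeasurable
    simpa [hξ.integral_eq_zero] using h1

theorem memLp (hξ : IsWhiteNoise P ξ) (k : ℕ) : MemLp (fun ω => (ξ k ω : ℂ)) 2 P :=
  (hξ.hasGaussianLaw k).memLp_two.ofReal

theorem orthonormal (hξ : IsWhiteNoise P ξ) : Orthonormal ℂ fun k => (hξ.memLp k).toLp _ := by
  rw [orthonormal_iff_ite]
  intro j k
  have h : inner ℂ ((hξ.memLp j).toLp _) ((hξ.memLp k).toLp _) =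
      ((∫ ω, ξ j ω * ξ k ω ∂P : ℝ) : ℂ) := by
    rw [← integral_complex_ofReal, L2.inner_def]
    refine integral_congr_ae ?_
    filter_upwards [(hξ.memLp j).coeFn_toLp, (hξ.memLp k).coeFn_toLp] with ω h1 h2
    rw [h1, h2, RCLike.inner_apply, Complex.conj_ofReal]
    push_cast
    ring
  rw [h, hξ.integral_mul]
  split_ifs <;> simp

/-- The isometry `x ↦ ∑ x_k ξ_k`. -/
def isometry (hξ : IsWhiteNoise P ξ) : HardySeq →ₗᵢ[ℂ] Lp ℂ 2 P :=
  hξ.orthonormal.orthogonalFamily.linearIsometry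

theorem isometry_unit (hξ : IsWhiteNoise P ξ) (k : ℕ) :
    hξ.isometry (HardySeq.unit k) =ᵐ[P] fun ω => (ξ k ω : ℂ) := by
  have h : hξ.isometry (HardySeq.unit k) = (hξ.memLp k).toLp _ := by
    simp [isometry, HardySeq.unit, hξ.orthonormal.orthogonalFamily.linearIsometry_apply_single]
  rw [h]
  exact (hξ.memLp k).coeFn_toLp

/-- The mean is the inner product with the constant 1, a continuous functional vanishing on each
shock. -/
theorem integral_isometry (hξ : IsWhiteNoise P ξ) (x : HardySeq) :
    ∫ ω, hξ.isometry x ω ∂P = 0 := by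
  have := (hξ.hasGaussianLaw 0).isProbabilityMeasure
  have h1 : ∀ f : Lp ℂ 2 P, inner ℂ (indicatorConstLp 2 MeasurableSet.univ
      (measure_ne_top P _) (1 : ℂ)) f = ∫ ω, f ω ∂P := by
    intro f
    rw [L2.inner_indicatorConstLp_one, setIntegral_univ]
  have h2 := (hasSum_unit x).mapL hξ.isometry.toContinuousLinearMap
  have h3 := h2.mapL (innerSL ℂ (indicatorConstLp 2 MeasurableSet.univ
      (measure_ne_top P _) (1 : ℂ)))
  rw [← h1]
  refine h3.unique ?_
  refine hasSum_zero.congr_fun fun k => ?_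
  rw [map_smul, map_smul, innerSL_apply_apply, h1, LinearIsometry.coe_toContinuousLinearMap,
    integral_congr_ae (hξ.isometry_unit k), integral_complex_ofReal, hξ.integral_eq_zero]
  simp

theorem memLp_re (hξ : IsWhiteNoise P ξ) (x : HardySeq) :
    MemLp (fun ω => (hξ.isometry x ω).re) 2 P := (Lp.memLp (hξ.isometry x)).re

theorem integral_re (hξ : IsWhiteNoise P ξ) (x : HardySeq) :
    ∫ ω, (hξ.isometry x ω).re ∂P = 0 := by
  have := (hξ.hasGaussianLaw 0).isProbabilityMeasure
  have h := Complex.reCLM.integral_comp_comm ((Lp.memLp (hξ.isometry x)).integrable one_le_two)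
  simpa [hξ.integral_isometry] using h

/-- Since the shocks are real, the real part is the mean-square limit of the finite sums of `(x
k).re * ξ k`, which are Gaussian by independence. -/
theorem hasGaussianLaw_re (hξ : IsWhiteNoise P ξ) (x : HardySeq) :
    HasGaussianLaw (fun ω => (hξ.isometry x ω).re) P := by
  have := (hξ.hasGaussianLaw 0).isProbabilityMeasure
  refine hasGaussianLaw_of_tendsto (X := fun n ω => ∑ k ∈ Finset.range n, (x k).re * ξ k ω)
    (fun n => ?_) (fun n => ?_) (hξ.memLp_re x) (hξ.integral_re x) ?_
  · have h1 : IsGaussianProcess (fun k ω => (x k).re • ξ k ω) P :=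
      IsGaussianProcess.smul (X := ξ) (fun k => (x k).re)
        ⟨fun I => iIndepFun.hasGaussianLaw (fun i => hξ.hasGaussianLaw i)
          (hξ.indep.precomp Subtype.val_injective)⟩
    exact h1.hasGaussianLaw_fun_sum
  · rw [integral_finsetSum _ fun k _ => ((hξ.hasGaussianLaw k).integrable).const_mul _]
    exact Finset.sum_eq_zero fun k _ => by rw [integral_const_mul, hξ.integral_eq_zero, mul_zero]
  · have h1 := ((hξ.isometry.continuous.tendsto x).comp (hasSum_unit x).tendsto_sum_nat)
    have h2 := (Lp.tendsto_Lp_iff_tendsto_eLpNorm' _ _).1 h1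
    refine tendsto_of_tendsto_of_tendsto_of_le_of_le tendsto_const_nhds h2 (fun _ => zero_le)
      fun n => ?_
    refine eLpNorm_mono_ae ?_
    filter_upwards [coeFn_isometry_sum hξ.isometry hξ.isometry_unit x (Finset.range n)] with ω h3
    simp only [Function.comp_apply, Pi.sub_apply, h3]
    have h4 : ∑ k ∈ Finset.range n, (x k).re * ξ k ω =
        (∑ k ∈ Finset.range n, x k * (ξ k ω : ℂ)).re := by simp
    rw [h4, ← Complex.sub_re]
    exact Complex.abs_re_le_norm _

theorem isGaussianProcess (hξ : IsWhiteNoise P ξ) :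
    IsGaussianProcess (fun (x : HardySeq) ω => (hξ.isometry x ω).re) P where
  hasGaussianLaw I := by
    classical
    have hm : AEMeasurable (fun ω => I.restrict fun x => (hξ.isometry x ω).re) P :=
      aemeasurable_pi_lambda _ fun i => (hξ.memLp_re i).1.aemeasurable
    refine ⟨⟨fun L => ?_⟩⟩
    have h1 : HasGaussianLaw (fun ω => L (I.restrict fun x => (hξ.isometry x ω).re)) P := by
      -- These are the values of `L` on the standard basis. Being real, they pass through the real
      -- part, so `L` of the vector is the real part of the image of one sequence.
      let a : I → ℂ := fun i => ((L fun j => if i = j then 1 else 0 : ℝ) : ℂ)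
      refine (hξ.hasGaussianLaw_re (∑ i, a i • (i : HardySeq))).congr ?_
      filter_upwards [coeFn_isometry_sum hξ.isometry (x := fun i : I => (i : HardySeq))
        (fun i => ae_eq_rfl) a Finset.univ] with ω h2
      have h3 := L.toLinearMap.pi_apply_eq_sum_univ (I.restrict fun x => (hξ.isometry x ω).re)
      simp only [ContinuousLinearMap.coe_coe] at h3
      rw [h2, h3, Complex.re_sum]
      refine Finset.sum_congr rfl fun i _ => ?_
      rw [Complex.re_ofReal_mul, smul_eq_mul, mul_comm]
      rfl
    have h2 := h1.map_eq_gaussianReal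
    rw [integral_map hm (by fun_prop), variance_map (by fun_prop) hm,
      AEMeasurable.map_map_of_aemeasurable (by fun_prop) hm]
    exact h2

end IsWhiteNoise

/-! ### Market demand in the Hilbert space of the shocks -/

namespace IsMarketDemand

open HardySeq

variable {Ω : Type*} [MeasurableSpace Ω] {P : Measure Ω} {μ : ℝ} {ψ : ℕ → ℝ} {ε D : ℤ → Ω → ℝ}

/-- Shocks are indexed backwards from τ, so that the shift on sequences corresponds to the backshift
in time. -/
theorem isWhiteNoise (hD : IsMarketDemand P μ ψ ε D) (τ : ℤ) :
    IsWhiteNoise P fun k : ℕ => ε (τ - k) where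
  measurable k := hD.measurable_shock _
  indep := hD.indep_shock.precomp (g := fun k : ℕ => τ - k) fun j k h => by simpa using h
  law k := hD.law_shock _

/-- The coefficients `ψ` as an element of `HardySeq`. -/
def coeff (hD : IsMarketDemand P μ ψ ε D) : HardySeq :=
  HardySeq.mk (fun k => (ψ k : ℂ)) (by simpa using hD.sq_summable)

theorem memLp_demand (hD : IsMarketDemand P μ ψ ε D) (t : ℤ) :
    MemLp (fun ω => ((D t ω - μ : ℝ) : ℂ)) 2 P := by
  obtain ⟨m, hm⟩ := ((hD.moving_average t).eventually (gt_mem_nhds ENNReal.zero_lt_top)).exists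
  have hmeas : Measurable fun ω => D t ω - μ - ∑ k ∈ Finset.range m, ψ k * ε (t - k) ω :=
    ((hD.measurable_demand t).sub_const μ).sub
      (Finset.measurable_fun_sum _ fun k _ => (hD.measurable_shock _).const_mul _)
  have h1 : MemLp (fun ω => D t ω - μ - ∑ k ∈ Finset.range m, ψ k * ε (t - k) ω) 2 P :=
    ⟨hmeas.aestronglyMeasurable, hm⟩
  have h2 : MemLp (fun ω => ∑ k ∈ Finset.range m, ψ k * ε (t - k) ω) 2 P :=
    memLp_finsetSum _ fun k _ => ((hD.isWhiteNoise t).hasGaussianLaw k).memLp_two.const_mul _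
  have h3 : MemLp (fun ω => D t ω - μ) 2 P := by
    convert h1.add h2 using 1
    ext ω
    simp
  exact h3.ofReal

/-- Both sides are the L² limit of the same moving-average partial sums. -/
theorem demand_ae_eq (hD : IsMarketDemand P μ ψ ε D) (τ : ℤ) (m : ℕ) :
    (hD.isWhiteNoise τ).isometry ((shiftL ^ m) hD.coeff) =ᵐ[P]
      fun ω => ((D (τ - m) ω - μ : ℝ) : ℂ) := by
  set V := (hD.isWhiteNoise τ).isometry
  have hs : HasSum (fun k => (ψ k : ℂ) • HardySeq.unit (k + m)) ((shiftL ^ m) hD.coeff) := by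
    have h := (hasSum_unit hD.coeff).mapL (shiftL ^ m)
    simpa only [map_smul, shiftL_pow_unit, coeff, mk_apply] using h
  have h1 := (V.continuous.tendsto _).comp hs.tendsto_sum_nat
  have h2 : Tendsto (V ∘ fun n => ∑ k ∈ Finset.range n, (ψ k : ℂ) • HardySeq.unit (k + m)) atTop
      (𝓝 ((hD.memLp_demand (τ - m)).toLp _)) := by
    rw [Lp.tendsto_Lp_iff_tendsto_eLpNorm]
    refine (hD.moving_average (τ - m)).congr fun n => ?_
    refine eLpNorm_congr_norm_ae ?_
    filter_upwards [coeFn_isometry_sum V (x := fun k => HardySeq.unit (k + m))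
      (fun k => (hD.isWhiteNoise τ).isometry_unit (k + m)) (fun k => (ψ k : ℂ))
      (Finset.range n)] with ω h3
    have h4 : ∀ k : ℕ, τ - ((k + m : ℕ) : ℤ) = τ - m - k := fun k => by push_cast; ring
    simp only [h4] at h3
    rw [Function.comp_apply, Pi.sub_apply, h3, norm_sub_rev, ← Complex.norm_real]
    push_cast
    rfl
  rw [tendsto_nhds_unique h1 h2]
  exact (hD.memLp_demand (τ - m)).coeFn_toLp

/-- Pulling the invertibility approximation of ε_0 back through the isometry gives an approximation
of the constant 1 by polynomial multiples of ψ. -/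
theorem isCyclic (hD : IsMarketDemand P μ ψ ε D) : IsCyclic hD.coeff := by
  refine isCyclic_of_approx fun δ hδ => ?_
  obtain ⟨m, c, h⟩ := hD.invertible 0 δ hδ
  set V := (hD.isWhiteNoise 0).isometry
  refine ⟨∑ k ∈ Finset.range m, C (c k : ℂ) * X ^ k, ?_⟩
  have h1 : aeval shiftL (∑ k ∈ Finset.range m, C (c k : ℂ) * X ^ k) hD.coeff =
      ∑ k ∈ Finset.range m, (c k : ℂ) • (shiftL ^ k) hD.coeff := by
    rw [map_sum, _root_.sum_apply]
    refine Finset.sum_congr rfl fun k _ => ?_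
    rw [map_mul, aeval_C, map_pow, aeval_X, ← Algebra.smul_def]
    rfl
  rw [h1, ← V.norm_map, Lp.norm_def]
  refine ENNReal.toReal_lt_of_lt_ofReal (lt_of_eq_of_lt ?_ h)
  refine eLpNorm_congr_norm_ae ?_
  rw [map_sub]
  filter_upwards [coeFn_isometry_sum V (hD.demand_ae_eq 0) (fun k => (c k : ℂ)) (Finset.range m),
    (hD.isWhiteNoise 0).isometry_unit 0, Lp.coeFn_sub (V (HardySeq.unit 0))
      (V (∑ k ∈ Finset.range m, (c k : ℂ) • (shiftL ^ k) hD.coeff))] with ω h2 h3 h4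
  rw [h4, Pi.sub_apply, h2, h3, ← Complex.norm_real]
  push_cast
  simp

theorem sellerDemand_ae_eq (hD : IsMarketDemand P μ ψ ε D) (N : ℕ) (T : ℝ[X]) (τ : ℤ) (m : ℕ) :
    (hD.isWhiteNoise τ).isometry ((shiftL ^ m) ((1 / N : ℂ) •
      aeval shiftL (T.map (algebraMap ℝ ℂ)) hD.coeff)) =ᵐ[P]
      fun ω => ((sellerDemand N μ T D (τ - m) ω - μ / N : ℝ) : ℂ) := by
  have h1 : (shiftL ^ m) ((1 / N : ℂ) • aeval shiftL (T.map (algebraMap ℝ ℂ)) hD.coeff) =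
      ∑ k ∈ T.support, (1 / N * (T.coeff k : ℂ)) • (shiftL ^ (m + k)) hD.coeff := by
    rw [aeval_def, eval₂_map, eval₂_eq_sum, sum_def, _root_.sum_apply,
      Finset.smul_sum, map_sum]
    refine Finset.sum_congr rfl fun k _ => ?_
    rw [RingHom.comp_apply, ← Algebra.smul_def, pow_add, mul_smul]
    exact (map_smul (shiftL ^ m) (1 / N : ℂ) _).trans
      (congrArg _ (map_smul (shiftL ^ m) (T.coeff k : ℂ) ((shiftL ^ k) hD.coeff)))
  rw [h1]
  filter_upwards [coeFn_isometry_sum (hD.isWhiteNoise τ).isometry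
    (fun k => hD.demand_ae_eq τ (m + k)) (fun k => (1 / N * (T.coeff k : ℂ))) T.support] with ω h2
  rw [h2, sellerDemand, add_sub_cancel_left, Finset.mul_sum]
  push_cast
  refine Finset.sum_congr rfl fun k _ => ?_
  rw [sub_sub, mul_assoc]

theorem measurable_sellerDemand (hD : IsMarketDemand P μ ψ ε D) (N : ℕ) (T : ℝ[X]) (t : ℤ) :
    Measurable (sellerDemand N μ T D t) :=
  ((Finset.measurable_fun_sum _ fun _ _ => ((hD.measurable_demand _).sub_const μ).const_mul
    _).const_mul _).const_add _

end IsMarketDemand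

/-! ### Forecast errors of processes driven by white noise -/

namespace HardySeq

theorem exists_split (x : HardySeq) (m : ℕ) :
    ∃ w : HardySeq, x = ∑ k ∈ Finset.range m, x k • unit k + (shiftL ^ m) w := by
  have hw : Summable fun k => ‖x (k + m)‖ ^ 2 :=
    (summable_nat_add_iff m (f := fun k => ‖x k‖ ^ 2)).2 (summable_sq x)
  refine ⟨mk (fun k => x (k + m)) hw, ?_⟩
  have h1 := hasSum_unit x
  have h2 := (hasSum_unit (mk (fun k => x (k + m)) hw)).mapL (shiftL ^ m)
  simp only [map_smul, shiftL_pow_unit, mk_apply] at h2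
  have h3 := (hasSum_nat_add_iff' m).2 h1
  rw [← h3.unique h2]
  abel

theorem inner_unit (x : HardySeq) (k : ℕ) : inner ℂ (unit k) x = x k := by
  rw [unit, lp.inner_single_left]; simp

theorem sum_shiftL_apply (x : HardySeq) {L k : ℕ} (hk : k ≤ L) :
    (∑ l ∈ Finset.range (L + 1), (shiftL ^ l) x : HardySeq) k =
      ∑ j ∈ Finset.range (k + 1), x j := by
  have h1 : (∑ l ∈ Finset.range (L + 1), (shiftL ^ l) x : HardySeq) k =
      ∑ l ∈ Finset.range (L + 1), (shiftL ^ l) x k := by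
    rw [lp.coeFn_sum, Finset.sum_apply]
  rw [h1, ← Finset.sum_range_reflect (fun j => x j),
    ← Finset.sum_subset (s₁ := Finset.range (k + 1)) (Finset.range_subset_range.2 (by omega))
      fun l _ hl => shiftL_pow_apply_of_lt x (by simpa using hl)]
  refine Finset.sum_congr rfl fun l hl => ?_
  have h2 : k = (k + 1 - 1 - l) + l := by have := Finset.mem_range.1 hl; omega
  conv_lhs => rw [h2]
  exact shiftL_pow_apply_add x l _

end HardySeq

/-- The variance conditional on `m` of a variable independent of `m`. -/
theorem condVar_of_split {Ω : Type*} {m m₀ : MeasurableSpace Ω} {P : Measure[m₀] Ω}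
    [IsProbabilityMeasure P] (hm : m ≤ m₀) {X F G : Ω → ℝ} (hX : X =ᵐ[P] F + G)
    (hF : Measurable[m₀] F) (hF2 : MemLp F 2 P) (hF0 : P[F] = 0)
    (hind : Indep (MeasurableSpace.comap F inferInstance) m P)
    (hG : AEStronglyMeasurable[m] G P) (hG2 : MemLp G 2 P) :
    condVar m (fun ω => X ω - (P[X | m]) ω) P =ᵐ[P] fun _ => ∫ ω, F ω * X ω ∂P := by
  have hFi := hF2.integrable one_le_two
  have hGi := hG2.integrable one_le_two
  have hFm : StronglyMeasurable[MeasurableSpace.comap F inferInstance] F :=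
    (comap_measurable F).stronglyMeasurable
  have hF1 : P[F | m] =ᵐ[P] 0 := by
    refine (condExp_indep_eq hF.comap_le hm hFm hind).trans ?_
    rw [hF0]
    rfl
  have hXm : P[X | m] =ᵐ[P] G := by
    refine (condExp_congr_ae hX).trans ((condExp_add hFi hGi m).trans ?_)
    filter_upwards [hF1, condExp_of_aestronglyMeasurable' hm hG hGi] with ω h1 h2
    simp [h1, h2]
  have hR : (fun ω => X ω - (P[X | m]) ω) =ᵐ[P] F := by
    filter_upwards [hX, hXm] with ω h1 h2
    simp [h1, h2]
  have hR2 : ((fun ω => X ω - (P[X | m]) ω) - P[fun ω => X ω - (P[X | m]) ω | m]) ^ 2 =ᵐ[P]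
      F ^ 2 := by
    filter_upwards [hR, (condExp_congr_ae hR).trans hF1] with ω h1 h2
    simp only [Pi.pow_apply, Pi.sub_apply, h1, h2, Pi.zero_apply, sub_zero]
  -- This orthogonality replaces E[F²] by E[F X], a covariance that the isometry computes directly.
  have hFG : ∫ ω, F ω * G ω ∂P = 0 := by
    rw [← integral_condExp hm]
    have h1 : P[fun ω => F ω * G ω | m] =ᵐ[P] 0 := by
      refine (condExp_mul_of_aestronglyMeasurable_right hG (hF2.integrable_mul hG2) hFi).trans ?_
      filter_upwards [hF1] with ω h2
      simp [h2]
    rw [integral_congr_ae h1]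
    simp
  have hFX : ∫ ω, F ω * X ω ∂P = ∫ ω, (F ^ 2) ω ∂P := by
    have h1 : (fun ω => F ω * X ω) =ᵐ[P] fun ω => (F ^ 2) ω + F ω * G ω := by
      filter_upwards [hX] with ω h2
      rw [h2, Pi.add_apply, Pi.pow_apply]
      ring
    have h2 : Integrable (fun ω => (F ^ 2) ω) P := hF2.integrable_sq
    have h3 : Integrable (fun ω => F ω * G ω) P := hF2.integrable_mul hG2
    rw [integral_congr_ae h1, integral_add h2 h3, hFG, add_zero]
  rw [hFX]
  exact (condExp_congr_ae hR2).trans (condExp_indep_eq hF.comap_le hm (hFm.pow 2) hind)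

namespace IsWhiteNoise

open HardySeq

variable {Ω : Type*} [MeasurableSpace Ω] {P : Measure Ω} {ξ : ℕ → Ω → ℝ}

theorem integral_re_mul (hξ : IsWhiteNoise P ξ) (x : HardySeq) {y : HardySeq} {Z : Ω → ℝ}
    (hZ : hξ.isometry y =ᵐ[P] fun ω => (Z ω : ℂ)) :
    ∫ ω, (hξ.isometry x ω).re * Z ω ∂P = (inner ℂ y x).re := by
  rw [← hξ.isometry.inner_map_map, L2.inner_def]
  have h1 := Complex.reCLM.integral_comp_comm
    (L2.integrable_inner (𝕜 := ℂ) (hξ.isometry y) (hξ.isometry x))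
  rw [Complex.reCLM_apply] at h1
  rw [← h1]
  refine integral_congr_ae ?_
  filter_upwards [hZ] with ω h2
  rw [h2, RCLike.inner_apply, Complex.conj_ofReal, Complex.reCLM_apply, Complex.re_mul_ofReal]

/-- The lead-time forecast error of a process whose innovations representation has
coefficients `θ`. -/
theorem leadTimeMSFE_eq (hξ : IsWhiteNoise P ξ) {Y : ℤ → Ω → ℝ} (hYm : ∀ t, Measurable (Y t))
    (c : ℝ) {J : HardySeq →ₗᵢ[ℂ] HardySeq} (hJ : ∀ x, J (shift x) = shift (J x)) {o : HardySeq}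
    (ho : IsCyclic o) (L : ℕ) (t : ℤ)
    (hY : ∀ m : ℕ, hξ.isometry ((shiftL ^ m) (J o)) =ᵐ[P]
      fun ω => ((Y (t + 1 + L - m) ω - c : ℝ) : ℂ))
    {θ : ℕ → ℝ} (hθ : ∀ k, o k = θ k) :
    leadTimeMSFE P Y L t =ᵐ[P] fun _ =>
      ∑ l ∈ Finset.range (L + 1), (∑ k ∈ Finset.range (L - l + 1), θ k) ^ 2 := by
  have := (hξ.hasGaussianLaw 0).isProbabilityMeasure
  have hm : historySigma Y t ≤ ‹MeasurableSpace Ω› := iSup_le fun s => (hYm s).comap_le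
  have hYt : ∀ s ≤ t, Measurable[historySigma Y t] (Y s) := fun s hs =>
    Measurable.of_comap_le (le_iSup (fun s : {s : ℤ // s ≤ t} =>
      MeasurableSpace.comap (Y s) inferInstance) ⟨s, hs⟩)
  have hJm : ∀ (m : ℕ) x, J ((shiftL ^ m) x) = (shiftL ^ m) (J x) := by
    intro m x
    induction m with
    | zero => simp
    | succ m ih =>
      rw [pow_succ', mul_apply_eq_comp, mul_apply_eq_comp, ← ih]
      exact hJ _
  set s : HardySeq := ∑ l ∈ Finset.range (L + 1), (shiftL ^ l) o with hs
  have hsk : ∀ k ≤ L, s k = ((∑ j ∈ Finset.range (k + 1), θ j : ℝ) : ℂ) := by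
    intro k hk
    rw [hs, sum_shiftL_apply o hk]
    push_cast
    exact Finset.sum_congr rfl fun j _ => hθ j
  obtain ⟨w, hw⟩ := exists_split s (L + 1)
  set R : HardySeq := ∑ k ∈ Finset.range (L + 1), s k • HardySeq.unit k with hR
  set F : Ω → ℝ := fun ω => (hξ.isometry (J R) ω).re with hF
  set G : Ω → ℝ := fun ω => (hξ.isometry (J ((shiftL ^ (L + 1)) w)) ω).re + (L + 1) * c with hG
  have hlead : hξ.isometry (J s) =ᵐ[P]
      fun ω => ((leadTimeDemand Y L (t + 1) ω - (L + 1) * c : ℝ) : ℂ) := by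
    have h1 : J s = ∑ m ∈ Finset.range (L + 1), (1 : ℂ) • (shiftL ^ m) (J o) := by
      simp only [hs, map_sum, hJm, one_smul]
    rw [h1]
    filter_upwards [coeFn_isometry_sum hξ.isometry hY (fun _ => 1) (Finset.range (L + 1))]
      with ω h2
    -- Powers of the shift count back from period t + 1 + L while lead-time demand counts forward
    -- from t + 1, so the sum is reversed.
    have h3 : ∀ m ∈ Finset.range (L + 1),
        Y (t + 1 + ((L + 1 - 1 - m : ℕ) : ℤ)) ω = Y (t + 1 + L - m) ω := by
      intro m hmL
      have := Finset.mem_range.1 hmL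
      rw [show t + 1 + ((L + 1 - 1 - m : ℕ) : ℤ) = t + 1 + L - m by omega]
    rw [h2, leadTimeDemand, ← Finset.sum_range_reflect (fun l : ℕ => Y (t + 1 + l) ω),
      Finset.sum_congr rfl h3]
    simp [Finset.sum_sub_distrib]
  have hinner : ∀ x, inner ℂ x R = ∑ k ∈ Finset.range (L + 1), s k * (starRingEnd ℂ) (x k) := by
    intro x
    rw [hR, inner_sum]
    refine Finset.sum_congr rfl fun k _ => ?_
    rw [inner_smul_right, ← inner_conj_symm, inner_unit]
  have hFG : leadTimeDemand Y L (t + 1) =ᵐ[P] F + G := by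
    have h1 : J s = J R + J ((shiftL ^ (L + 1)) w) := by rw [← map_add, ← hw]
    have h2 := Lp.coeFn_add (hξ.isometry (J R)) (hξ.isometry (J ((shiftL ^ (L + 1)) w)))
    rw [← map_add, ← h1] at h2
    filter_upwards [hlead, h2] with ω h3 h4
    have h5 := congrArg Complex.re (h3.symm.trans h4)
    rw [Complex.ofReal_re, Pi.add_apply, Complex.add_re] at h5
    rw [Pi.add_apply, hF, hG]
    linarith
  have hFm : Measurable F :=
    Complex.measurable_re.comp (Lp.stronglyMeasurable (hξ.isometry (J R))).measurable
  -- Demands at times ≤ t are those with m ≥ L + 1. Removing `J`, they start at degree L + 1,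
  -- whereas `R` stops at degree L.
  have hcov : ∀ m : ℕ, L + 1 ≤ m → (inner ℂ ((shiftL ^ m) (J o)) (J R)).re = 0 := by
    intro m hmL
    rw [← hJm, J.inner_map_map, hinner, Finset.sum_eq_zero]
    · rfl
    · intro k hk
      rw [shiftL_pow_apply_of_lt o (by have := Finset.mem_range.1 hk; omega), map_zero, mul_zero]
  have hVY : ∀ r : {r : ℤ // r ≤ t}, hξ.isometry ((shiftL ^ (t + 1 + L - r).toNat) (J o)) =ᵐ[P]
      fun ω => ((Y r ω - c : ℝ) : ℂ) := by
    intro r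
    have h1 := hY (t + 1 + L - r).toNat
    rwa [show t + 1 + L - ((t + 1 + L - r).toNat : ℤ) = r by have := r.2; omega] at h1
  have hgp : IsGaussianProcess (Sum.elim (fun _ : Unit => F)
      (fun (r : {r : ℤ // r ≤ t}) ω => Y r ω - c)) P := by
    refine (hξ.isGaussianProcess.comp_right (Sum.elim (fun _ : Unit => J R)
      (fun r : {r : ℤ // r ≤ t} => (shiftL ^ (t + 1 + L - r).toNat) (J o)))).congr ?_
    rintro (_ | r)
    · exact ae_eq_rfl
    · filter_upwards [hVY r] with ω h1
      simp only [Function.comp_apply, Sum.elim_inr, h1, Complex.ofReal_re]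
  have hind : Indep (MeasurableSpace.comap F inferInstance) (historySigma Y t) P := by
    have h1 := hgp.indepFun_of_covariance_eq_zero (fun _ => hFm.aemeasurable)
      (fun r => ((hYm r).sub_const c).aemeasurable) fun _ r => by
        have hYr : MemLp (fun ω => Y r ω - c) 2 P := (hgp.hasGaussianLaw_eval (Sum.inr r)).memLp_two
        rw [covariance_eq_sub (hξ.memLp_re _) hYr, hξ.integral_re, zero_mul, sub_zero]
        refine (hξ.integral_re_mul _ (hVY r)).trans (hcov _ ?_)
        have := r.2
        omega
    have hφ : Measurable fun f : Unit → ℝ => f () := measurable_pi_apply ()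
    -- Adding `c` back turns the centred history into the history of `Y` itself.
    have hψ : Measurable fun (f : {r : ℤ // r ≤ t} → ℝ) r => f r + c := by fun_prop
    have h2 := h1.comp hφ hψ
    have h3 : historySigma Y t = MeasurableSpace.comap
        (fun ω (r : {r : ℤ // r ≤ t}) => Y r ω) MeasurableSpace.pi := by
      simp only [historySigma, MeasurableSpace.pi, MeasurableSpace.comap_iSup,
        MeasurableSpace.comap_comp]
      rfl
    rw [h3]
    simpa [Function.comp_def, IndepFun_iff_Indep] using h2
  have hGm : AEStronglyMeasurable[historySigma Y t] G P := by
    have h1 : AEStronglyMeasurable[historySigma Y t]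
        (hξ.isometry (J ((shiftL ^ (L + 1)) w))) P := by
      -- History-measurability is a closed condition in L², so by cyclicity `w` may be taken to be a
      -- polynomial multiple of `o`; its image is then a finite combination of demands up to time t.
      refine ho.induction_on w ((isClosed_aestronglyMeasurable hm).preimage
        (f := fun x => hξ.isometry (J ((shiftL ^ (L + 1)) x))) ?_) fun p => ?_
      · exact hξ.isometry.continuous.comp (J.continuous.comp (shiftL ^ (L + 1)).continuous)
      · have h2 : J ((shiftL ^ (L + 1)) (aeval shiftL p o)) =
            ∑ k ∈ p.support, p.coeff k • (shiftL ^ (L + 1 + k)) (J o) := by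
          rw [aeval_def, eval₂_eq_sum, sum_def, _root_.sum_apply, map_sum, map_sum]
          refine Finset.sum_congr rfl fun k _ => ?_
          rw [← Algebra.smul_def, ← hJm, pow_add shiftL (L + 1) k, ← map_smul]
          exact congrArg J (map_smul (shiftL ^ (L + 1)) (p.coeff k) ((shiftL ^ k) o))
        have h3 := coeFn_isometry_sum hξ.isometry (fun k => hY (L + 1 + k)) p.coeff p.support
        rw [← h2] at h3
        refine AEStronglyMeasurable.congr (Measurable.aestronglyMeasurable ?_) h3.symm
        refine Finset.measurable_fun_sum _ fun k _ => Measurable.const_mul ?_ _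
        refine Complex.measurable_ofReal.comp (Measurable.sub_const (hYt _ ?_) _)
        push_cast
        omega
    exact (Complex.continuous_re.comp_aestronglyMeasurable h1).add aestronglyMeasurable_const
  refine (condVar_of_split hm hFG hFm (hξ.memLp_re _) (hξ.integral_re _) hind hGm
    ((hξ.memLp_re _).add (memLp_const _))).trans (Eventually.of_forall fun _ => ?_)
  have hlp : MemLp (fun ω => leadTimeDemand Y L (t + 1) ω - (L + 1) * c) 2 P := by
    have h1 := hξ.memLp_re (J s)
    refine (memLp_congr_ae ?_).1 h1
    filter_upwards [hlead] with ω h2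
    rw [h2, Complex.ofReal_re]
  have h1 : ∀ ω, F ω * leadTimeDemand Y L (t + 1) ω =
      F ω * (leadTimeDemand Y L (t + 1) ω - (L + 1) * c) + F ω * ((L + 1) * c) := fun ω => by ring
  have h2 : Integrable (fun ω => F ω * (leadTimeDemand Y L (t + 1) ω - (L + 1) * c)) P :=
    (hξ.memLp_re _).integrable_mul hlp
  have h3 : Integrable (fun ω => F ω * ((L + 1) * c)) P :=
    ((hξ.memLp_re _).integrable one_le_two).mul_const _
  simp only [h1]
  rw [integral_add h2 h3, integral_mul_const, hξ.integral_re,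
    zero_mul, add_zero, hξ.integral_re_mul _ hlead, J.inner_map_map, hinner,
    ← Finset.sum_range_reflect, Complex.re_sum]
  refine Finset.sum_congr rfl fun l hl => ?_
  have hl' := Finset.mem_range.1 hl
  rw [show L + 1 - 1 - l = L - l by omega, hsk _ (Nat.sub_le _ _), Complex.conj_ofReal,
    ← Complex.ofReal_mul, Complex.ofReal_re, sq]

end IsWhiteNoise

/-! ### Reversed polynomials -/

/-- Applied twice: with `u` a shift of `x` in ℓ², for the operator isometry, and in ℂ with |u| = 1,
for boundary moduli. -/
theorem norm_sub_smul_eq {V : Type*} [NormedAddCommGroup V] [InnerProductSpace ℂ V] {x u : V}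
    (a : ℝ) (hu : ‖u‖ = ‖x‖) : ‖x - (a : ℂ) • u‖ = ‖(a : ℂ) • x - u‖ := by
  rw [← sq_eq_sq₀ (norm_nonneg _) (norm_nonneg _), @norm_sub_sq ℂ, @norm_sub_sq ℂ, norm_smul,
    norm_smul, hu, inner_smul_right, inner_smul_left, Complex.conj_ofReal]
  ring

/-- Reversing the coefficients 1, a, a exchanges the cross terms of (x, u) and (u, v), which `h`
makes equal. For u = Sx and v = S²x this holds because `S` is an isometry. -/
theorem norm_add_smul_add_smul_eq {V : Type*} [NormedAddCommGroup V] [InnerProductSpace ℂ V]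
    {x u v : V} (a : ℝ) (hv : ‖v‖ = ‖x‖) (h : inner ℂ x u = inner ℂ u v) :
    ‖x + (a : ℂ) • u + (a : ℂ) • v‖ = ‖(a : ℂ) • x + (a : ℂ) • u + v‖ := by
  rw [← sq_eq_sq₀ (norm_nonneg _) (norm_nonneg _), @norm_add_sq ℂ, @norm_add_sq ℂ, @norm_add_sq ℂ,
    @norm_add_sq ℂ]
  simp only [norm_smul, hv, inner_add_left, inner_smul_right, inner_smul_left, Complex.conj_ofReal,
    h]
  simp only [map_add, RCLike.re_to_complex, Complex.re_ofReal_mul, Complex.add_re]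
  ring

theorem sub_ne_zero_of_norm_lt {a : ℝ} (ha : 1 < |a|) {w : ℂ} (hw : ‖w‖ ≤ 1) : (a : ℂ) - w ≠ 0 := by
  intro h
  rw [← sub_eq_zero.1 h, Complex.norm_real, Real.norm_eq_abs] at hw
  linarith

/-- The roots of `z² + a z + a` lie outside the closed unit disk when `1 < a`. -/
theorem sq_add_mul_add_ne_zero {a : ℝ} (ha : 1 < a) {z : ℂ} (hz : ‖z‖ ≤ 1) :
    (a : ℂ) + a * z + z ^ 2 ≠ 0 := by
  intro h
  have hre := congrArg Complex.re h
  have him := congrArg Complex.im h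
  simp [sq] at hre him
  have hn : z.re ^ 2 + z.im ^ 2 ≤ 1 := by
    have h1 := Complex.sq_norm z
    rw [Complex.normSq_apply] at h1
    nlinarith [norm_nonneg z]
  have h2 : z.im * (a + 2 * z.re) = 0 := by linarith
  -- A real root x ≥ -1 would give a(1 + x) + x² ≥ 1 + x + x² > 0. Otherwise Re z = -a/2, and the
  -- real part forces |z|² = a > 1.
  rcases mul_eq_zero.1 h2 with h3 | h3
  · rw [h3] at hre hn
    have h4 : 0 ≤ 1 + z.re := by nlinarith
    nlinarith [mul_nonneg (sub_nonneg.2 ha.le) h4, sq_nonneg (z.re + 1 / 2)]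
  · nlinarith

namespace HardySeq

theorem IsCyclic.smul {x : HardySeq} (hx : IsCyclic x) {c : ℂ} (hc : c ≠ 0) :
    IsCyclic (c • x) := by
  have h := hx.aeval_of_isUnit (isUnit_aeval (Q := C c) fun z _ => by rwa [eval_C])
  rwa [aeval_C, Algebra.algebraMap_eq_smul_one] at h

theorem eval_zero (x : HardySeq) (h : ‖(0 : ℂ)‖ < 1) : inner ℂ (kernel 0 h) x = x 0 := by
  refine (hasSum_eval x h).unique ?_
  convert hasSum_single (f := fun k => x k * (0 : ℂ) ^ k) 0 fun k hk => ?_ using 1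
  · simp
  · simp [hk]

/-- If the constant term vanished, so would that of every polynomial multiple, keeping them all at
distance at least 1 from the constant 1. -/
theorem IsCyclic.apply_zero_ne_zero {x : HardySeq} (hx : IsCyclic x) : x 0 ≠ 0 := by
  intro h
  obtain ⟨p, hp⟩ := Metric.denseRange_iff.1 hx (unit 0) 1 one_pos
  have h1 := eval_aeval p x (z := 0) (by simp)
  rw [eval_zero, eval_zero, h, mul_zero] at h1
  have h2 := lp.norm_apply_le_norm two_ne_zero (unit 0 - aeval shiftL p x) 0
  rw [← dist_eq_norm] at h2
  simp [h1, unit_apply] at h2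
  linarith

theorem aeval_quadratic (a b c : ℝ) (x : HardySeq) :
    aeval shiftL ((C a + C b * X + C c * X ^ 2).map (algebraMap ℝ ℂ)) x =
      (a : ℂ) • x + (b : ℂ) • shift x + (c : ℂ) • shift (shift x) := by
  simp only [Polynomial.map_add, Polynomial.map_mul, map_C, map_X, map_add,
    map_mul, aeval_C, aeval_X, ← Algebra.smul_def, pow_two]
  rw [Algebra.algebraMap_eq_smul_one (R := ℂ) (A := HardySeq →L[ℂ] HardySeq)]
  rfl

end HardySeq

/-! ### Factorization of seller demand. -/

namespace IsMarketDemand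

open HardySeq

variable {Ω : Type*} [MeasurableSpace Ω] {P : Measure Ω} {μ : ℝ} {ψ : ℕ → ℝ} {ε D : ℤ → Ω → ℝ}

theorem zTransform_eq (hD : IsMarketDemand P μ ψ ε D) {z : ℂ} (hz : ‖z‖ < 1) :
    zTransform ψ z = inner ℂ (kernel z hz) hD.coeff := (hasSum_eval hD.coeff hz).tsum_eq

/-- The seller's inner-outer factorization and forecast error, when the transfer polynomial `T`
is reflected into a polynomial `Q` without zeros in the closed disk. -/
theorem exists_factorization (hD : IsMarketDemand P μ ψ ε D) {N : ℕ} (hN : N ≠ 0) {T Q : ℝ[X]}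
    (hQ : ∀ z : ℂ, ‖z‖ ≤ 1 → aeval z Q ≠ 0)
    (hTS : ∀ y, ‖aeval shiftL (T.map (algebraMap ℝ ℂ)) y‖ =
      ‖aeval shiftL (Q.map (algebraMap ℝ ℂ)) y‖)
    (hT : ∀ z : ℂ, ‖z‖ = 1 → ‖aeval z T‖ = ‖aeval z Q‖) {θ : ℕ → ℝ}
    (hθ : ∀ k, (1 / N : ℂ) * aeval shiftL (Q.map (algebraMap ℝ ℂ)) hD.coeff k = θ k) :
    ∃ (O I : ℂ → ℂ) (B : ℝ → ℂ),
      IsOuter O ∧ IsInner I ∧ (∀ z : ℂ, ‖z‖ < 1 → sellerTransform N ψ T z = O z * I z) ∧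
      IsBoundaryValue O B ∧
      (∀ k : ℕ, boundaryCoeff B k = (θ k : ℂ)) ∧
      ∀ (L : ℕ) (t : ℤ),
        leadTimeMSFE P (sellerDemand N μ T D) L t =ᵐ[P] fun _ =>
          ∑ l ∈ Finset.range (L + 1), (∑ k ∈ Finset.range (L - l + 1), θ k) ^ 2 := by
  set Tc := T.map (algebraMap ℝ ℂ) with hTc
  set Qc := Q.map (algebraMap ℝ ℂ) with hQc
  have hTe : ∀ z : ℂ, Tc.eval z = aeval z T := fun z => eval_map_algebraMap T z
  have hQe : ∀ z : ℂ, Qc.eval z = aeval z Q := fun z => eval_map_algebraMap Q z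
  simp only [← hQe, ← hTe] at hQ hT
  have hu := isUnit_aeval hQ
  obtain ⟨J, hJ, hJQ⟩ := exists_innerOperator hu hTS
  have hNc : (1 / N : ℂ) ≠ 0 := one_div_ne_zero (Nat.cast_ne_zero.2 hN)
  set o : HardySeq := (1 / N : ℂ) • aeval shiftL Qc hD.coeff with ho
  have hoc : IsCyclic o := (hD.isCyclic.aeval_of_isUnit hu).smul hNc
  have hoθ : ∀ k, o k = θ k := hθ
  have hO : ∀ z : ℂ, ∀ hz : ‖z‖ < 1,
      1 / N * zTransform ψ z * Qc.eval z = inner ℂ (kernel z hz) o := by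
    intro z hz
    rw [ho, inner_smul_right, eval_aeval, hD.zTransform_eq hz]
    ring
  refine ⟨fun z => 1 / N * zTransform ψ z * Qc.eval z, fun z => Tc.eval z / Qc.eval z, boundary o,
    hoc.isOuter hO, isInner_of_div hQ hT fun z hz => eval_innerOperator hu hJQ hz, fun z hz => ?_,
    isBoundaryValue hO, fun k => by rw [boundaryCoeff_boundary, hoθ], fun L t => ?_⟩
  · have h0 := hQ z hz.le
    rw [sellerTransform, ← hTe]
    field_simp
  -- The origin is the last period of the lead-time window, so every demand involved is a
  -- nonnegative power of the shift.
  · refine (hD.isWhiteNoise (t + 1 + L)).leadTimeMSFE_eq (hD.measurable_sellerDemand N T) (μ / N)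
      hJ hoc L t (fun m => ?_) hoθ
    rw [ho, map_smul, hJQ]
    exact hD.sellerDemand_ae_eq N T (t + 1 + L) m

end IsMarketDemand

end

/-! ### The allocation policies. -/

theorem mainTheorem10 {Ω : Type*} [MeasurableSpace Ω] (P : Measure Ω) [IsProbabilityMeasure P]
    (μ : ℝ) (ψ : ℕ → ℝ) (ε D : ℤ → Ω → ℝ) (hD : IsMarketDemand P μ ψ ε D)
    (N : ℕ) (hN : Even N ∨ (Odd N ∧ 3 ≤ N))
    (σ : ℝ) (hσ : sigmaLower N ψ < σ)
    (n : ℕ) (hn : n ∈ Finset.Icc 1 N)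
    (T : ℝ[X]) (hT : T = transferPoly N (σ / sigmaLower N ψ) n)
    (α : ℝ) (hα : α = alphaCoeff N (σ / sigmaLower N ψ) n) :
    ∃ (O I : ℂ → ℂ) (B : ℝ → ℂ),
      IsOuter O ∧ IsInner I ∧ (∀ z : ℂ, ‖z‖ < 1 → sellerTransform N ψ T z = O z * I z) ∧
      IsBoundaryValue O B ∧
      (∀ k : ℕ, boundaryCoeff B k = (thetaCoeff N ψ α n k : ℂ)) ∧
      ∀ (L : ℕ) (t : ℤ),
        leadTimeMSFE P (sellerDemand N μ T D) L t =ᵐ[P] fun _ =>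
          ∑ l ∈ Finset.range (L + 1),
            (∑ k ∈ Finset.range (L - l + 1), thetaCoeff N ψ α n k) ^ 2 := by
  have hn' := Finset.mem_Icc.1 hn
  have hN0 : N ≠ 0 := by omega
  -- Invertibility gives this; it makes σ_L positive, so that σ / σ_L is a genuine quotient greater
  -- than 1.
  have hψ : ψ 0 ≠ 0 := by
    have h := hD.isCyclic.apply_zero_ne_zero
    simpa [IsMarketDemand.coeff] using h
  have hσL : 0 < sigmaLower N ψ := div_pos (abs_pos.2 hψ) (by exact_mod_cast Nat.pos_of_ne_zero hN0)
  have ha : 1 < σ / sigmaLower N ψ := (one_lt_div hσL).2 hσ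
  set a := σ / sigmaLower N ψ
  have hone : ∀ k : ℕ, HardySeq.shift hD.coeff k = ((psiExt ψ ((k : ℤ) - 1) : ℝ) : ℂ) := by
    intro k
    cases k <;> simp [psiExt, IsMarketDemand.coeff]
  have htwo : ∀ k : ℕ, HardySeq.shift (HardySeq.shift hD.coeff) k =
      ((psiExt ψ ((k : ℤ) - 2) : ℝ) : ℂ) := by
    intro k
    rcases k with _ | _ | k
    · simp [psiExt]
    · simp [psiExt]
    · have h : ((k + 1 + 1 : ℕ) : ℤ) - 2 = k := by push_cast; ring
      rw [h]
      simp [psiExt, IsMarketDemand.coeff]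
  have hzero : ∀ k : ℕ, hD.coeff k = ((psiExt ψ k : ℝ) : ℂ) := by
    intro k
    simp [psiExt, IsMarketDemand.coeff]
  have hcoeff : ∀ (b c d : ℝ) (k : ℕ), (1 / N : ℂ) *
      aeval HardySeq.shiftL ((C b + C c * X + C d * X ^ 2).map (algebraMap ℝ ℂ)) hD.coeff k =
      ((1 / N * (b * psiExt ψ k + c * psiExt ψ ((k : ℤ) - 1) + d * psiExt ψ ((k : ℤ) - 2)) : ℝ) :
        ℂ) := by
    intro b c d k
    rw [HardySeq.aeval_quadratic]
    simp only [lp.coeFn_add, lp.coeFn_smul, Pi.add_apply, Pi.smul_apply, smul_eq_mul, hzero, hone,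
      htwo]
    push_cast
    rfl
  have ha' : 1 < |a| := ha.trans_le (le_abs_self a)
  by_cases h1 : Odd N ∧ n = 1
  · have hαa : α = a := by rw [hα, alphaCoeff, if_pos ⟨h1.1, Or.inl h1.2⟩]
    have hT' : T = C 1 + C a * X + C a * X ^ 2 := by rw [hT, transferPoly, if_pos h1, C_1]
    -- The reversal z² T(1/z).
    refine hD.exists_factorization hN0 (Q := C a + C a * X + C 1 * X ^ 2) (fun z hz => ?_)
      (fun y => ?_) (fun z hz => ?_) fun k => ?_
    · simpa using sq_add_mul_add_ne_zero ha hz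
    · rw [hT', HardySeq.aeval_quadratic, HardySeq.aeval_quadratic]
      simpa using norm_add_smul_add_smul_eq (x := y) (u := HardySeq.shift y)
        (v := HardySeq.shift (HardySeq.shift y)) a (by simp)
        (HardySeq.shift.inner_map_map y (HardySeq.shift y)).symm
    · have h := norm_add_smul_add_smul_eq (x := (1 : ℂ)) (u := z) (v := z ^ 2) a (by simp [hz]) (by
        rw [RCLike.inner_apply, RCLike.inner_apply, sq, mul_assoc, Complex.mul_conj,
          Complex.normSq_eq_norm_sq, hz]
        simp)
      simpa [hT'] using h
    · rw [hcoeff, thetaCoeff, if_pos h1, hαa, one_mul]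
  by_cases h2 : Odd N ∧ n = 2
  · have hαa : α = a := by rw [hα, alphaCoeff, if_pos ⟨h2.1, Or.inr h2.2⟩]
    have hT' : T = C 1 + C 0 * X + C (-a) * X ^ 2 := by
      rw [hT, transferPoly, if_neg h1, if_pos h2]
      simp [sub_eq_add_neg]
    -- The reversal of 1 - a z² with its sign flipped, matching the sign of θ.
    refine hD.exists_factorization hN0 (Q := C a + C 0 * X + C (-1) * X ^ 2) (fun z hz => ?_)
      (fun y => ?_) (fun z hz => ?_) fun k => ?_
    · simpa [sub_eq_add_neg] using sub_ne_zero_of_norm_lt ha' (w := z ^ 2)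
        (by rw [norm_pow]; exact pow_le_one₀ (norm_nonneg _) hz)
    · rw [hT', HardySeq.aeval_quadratic, HardySeq.aeval_quadratic]
      simpa [sub_eq_add_neg] using norm_sub_smul_eq (x := y)
        (u := HardySeq.shift (HardySeq.shift y)) a (by simp)
    · simpa [hT', sub_eq_add_neg] using
        norm_sub_smul_eq (x := (1 : ℂ)) (u := z ^ 2) a (by simp [hz])
    · rw [hcoeff, thetaCoeff, if_neg h1, if_pos h2, hαa]
      ring_nf
  · have hαa : α = (-1) ^ (n + 1) * a := by
      rw [hα, alphaCoeff, if_neg]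
      tauto
    have hT' : T = C 1 + C (-α) * X + C 0 * X ^ 2 := by
      rw [hT, transferPoly, if_neg h1, if_neg h2, hαa, pow_succ]
      simp
    have hα' : 1 < |α| := by rw [hαa]; simpa [abs_mul]
    -- Here T = 1 - α z is reflected to α - z, whose root α has modulus a > 1 for either sign.
    refine hD.exists_factorization hN0 (Q := C α + C (-1) * X + C 0 * X ^ 2) (fun z hz => ?_)
      (fun y => ?_) (fun z hz => ?_) fun k => ?_
    · simpa [sub_eq_add_neg] using sub_ne_zero_of_norm_lt hα' hz
    · rw [hT', HardySeq.aeval_quadratic, HardySeq.aeval_quadratic]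
      simpa [sub_eq_add_neg] using norm_sub_smul_eq (x := y) (u := HardySeq.shift y) α (by simp)
    · simpa [hT', sub_eq_add_neg] using norm_sub_smul_eq (x := (1 : ℂ)) (u := z) α (by simp [hz])
    · rw [hcoeff, thetaCoeff, if_neg h1, if_neg h2]
      ring_nf
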